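/- **Definitions.** For $z\in\{0,1\}^n$ let $|z|$ be its number of ones, and let $\mathrm{GapMaj}(z)=1$ if $|z|\ge \frac23 n$, $\mathrm{GapMaj}(z)=0$ if $|z|\le\frac13 n$, and $\mathrm{GapMaj}(z)=*$ otherwise. For $a,b\in\{0,1\}^m$ let $\mathrm{IP}_m(a,b)=\sum_{i=1}^m a_ib_i \bmod 2$, and for $x,y\in(\{0,1\}^m)^n$ let $$(\mathrm{GapMaj}\circ\mathrm{IP}_m^n)(x,y)=\mathrm{GapMaj}\big(\mathrm{IP}_m(x_1,y_1),\dots,\mathrm{IP}_m(x_n,y_n)\big).$$ A *completion* of a partial function $g\colon X\times Y\to\{0,1,*\}$ is a total function $f\colon X\times Y\to\{0,1\}$ with $f(x,y)=g(x,y)$ whenever $g(x,y)\ne *$. The randomized communication complexity $\mathsf R(g)$ is the least $c$ such that some public-coin randomized two-party protocol that always sends at most $c$ bits outputs $g(x,y)$ with probability at least $2/3$ on every input $(x,y)$ with $g(x,y)\neq *$. The pseudodeterministic communication complexity $\mathsf{Ps}(g)$ is the least $c$ such that some such protocol that always sends at most $c$ bits computes some completion of $g$ with error at most $1/3$; that is,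 $\mathsf{Ps}(g)=\min_f \mathsf R(f)$ over all completions $f$ of $g$. Put $m(n)=\lceil 100\log_2 n\rceil$. **Theorem.** 1. There is a constant $c>0$ such that for all sufficiently large $n$, with $m=m(n)$, every completion $f$ of $\mathrm{GapMaj}\circ\mathrm{IP}_m^n$ satisfies $\mathsf R(f)\ge c\sqrt n\log_2 n$. 2. There is a constant $C$ such that for all sufficiently large $n$, with $m=m(n)$, $\mathsf R(\mathrm{GapMaj}\circ\mathrm{IP}_m^n)\le C\log_2 n$. 3. For $N\in\mathbb N$ let $n$ be the largest integer $n\le N$ with $n\cdot m(n)\le N$, and let $g_N\colon\{0,1\}^N\times\{0,1\}^N\to\{0,1,*\}$ be the partial function that regards the first $n\cdot m(n)$ bits of each input as $n$ consecutive blocks of $m(n)$ bits, ignores the other bits, and applies $\mathrm{GapMaj}\circ\mathrm{IP}_{m(n)}^n$. Then there are constants $c>0$ and $C$ such that for all sufficiently large $N$, $\mathsf R(g_N)\le C\log_2 N$ and $\mathsf{Ps}(g_N)\ge c\sqrt N$. -/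

import Mathlib

open Filter
open scoped ENNReal

namespace GapMajSep

/-! ### Two-party communication protocols -/

/-- Deterministic two-party protocol trees with Boolean output. At an inner node the player who owns
the node sends one bit, which depends on that player's own input (and, through the position in the
tree, on the bits sent so far); the execution continues in the left child if the bit is `false` and
in the right child if it is `true`. The output is the label of the leaf that is reached. -/
inductive Protocol (X Y : Type) : Type
  | output (b : Bool) : Protocol X Y
  | alice (msg : X → Bool) (left right : Protocol X Y) : Protocol X Y
  | bob (msg : Y → Bool) (left right : Protocol X Y) : Protocol X Y

/-- The output of a protocol on the input pair `(x, y)`. -/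
def Protocol.eval {X Y : Type} : Protocol X Y → X → Y → Bool
  | .output b, _, _ => b
  | .alice msg l r, x, y => bif msg x then r.eval x y else l.eval x y
  | .bob msg l r, x, y => bif msg y then r.eval x y else l.eval x y

/-- The cost of a protocol: the number of bits sent in the worst case, i.e. the depth of the tree. -/
def Protocol.cost {X Y : Type} : Protocol X Y → ℕ
  | .output _ => 0
  | .alice _ l r => max l.cost r.cost + 1
  | .bob _ l r => max l.cost r.cost + 1

/-- A (public-coin) randomized protocol: a probability distribution over deterministic protocols. -/
abbrev RandProtocol (X Y : Type) : Type := PMF (Protocol X Y)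

/-- The randomized protocol `μ` never sends more than `c` bits. -/
def RandProtocol.CostLE {X Y : Type} (μ : RandProtocol X Y) (c : ℕ) : Prop :=
  ∀ π ∈ μ.support, π.cost ≤ c

/-- The probability that the randomized protocol `μ` outputs `b` on the input pair `(x, y)`. -/
noncomputable def RandProtocol.prob {X Y : Type} (μ : RandProtocol X Y) (x : X) (y : Y) (b : Bool) :
    ℝ≥0∞ :=
  (μ.map fun π => π.eval x y) b

/-! ### Partial functions, completions and complexity measures -/

/-- A partial communication problem `X × Y → {0, 1, *}`, where `none` stands for `*`. -/
abbrev PartialProblem (X Y : Type) : Type := X → Y → Option Bool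

/-- A total function, seen as a partial problem that never takes the value `*`. -/
def ofTotal {X Y : Type} (f : X → Y → Bool) : PartialProblem X Y := fun x y => some (f x y)

/-- `f` is a completion of `g`: a total function that agrees with `g` wherever `g` is not `*`. -/
def IsCompletion {X Y : Type} (g : PartialProblem X Y) (f : X → Y → Bool) : Prop :=
  ∀ x y b, g x y = some b → f x y = b

/-- `μ` computes the partial problem `g` with error at most `1/3`; inputs on which `g` is `*` impose
no condition. -/
def RandProtocol.Computes {X Y : Type} (μ : RandProtocol X Y) (g : PartialProblem X Y) : Prop :=
  ∀ x y b, g x y = some b → 2 / 3 ≤ μ.prob x y b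

/-- `μ` computes `g` pseudodeterministically: it computes (with error at most `1/3`) some
completion of `g` into a total function. -/
def RandProtocol.ComputesPseudodet {X Y : Type} (μ : RandProtocol X Y) (g : PartialProblem X Y) :
    Prop :=
  ∃ f : X → Y → Bool, IsCompletion g f ∧ μ.Computes (ofTotal f)

/-- Randomized communication complexity, with error `1/3`. (The set of costs is nonempty when `X` is
finite, see `exists_randCC`.) -/
noncomputable def randCC {X Y : Type} (g : PartialProblem X Y) : ℕ :=
  sInf {c : ℕ | ∃ μ : RandProtocol X Y, μ.CostLE c ∧ μ.Computes g}

/-- Pseudodeterministic communication complexity. (The set of costs is nonempty when `X` is finite,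
see `exists_pseudodetCC`.) -/
noncomputable def pseudodetCC {X Y : Type} (g : PartialProblem X Y) : ℕ :=
  sInf {c : ℕ | ∃ μ : RandProtocol X Y, μ.CostLE c ∧ μ.ComputesPseudodet g}

/-! The two infima above are attained. -/

theorem exists_protocol {X Y : Type} [Finite X] (f : X → Y → Bool) :
    ∃ π : Protocol X Y, ∀ x y, π.eval x y = f x y := by
  classical
  cases nonempty_fintype X
  have key : ∀ s : Finset X, ∃ π : Protocol X Y, ∀ x ∈ s, ∀ y, π.eval x y = f x y := by
    intro s
    induction s using Finset.induction_on with
    | empty => exact ⟨.output false, by simp⟩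
    | insert a s _ ih =>
      obtain ⟨π, hπ⟩ := ih
      refine ⟨.alice (fun x => decide (x = a)) π
        (.bob (fun y => f a y) (.output false) (.output true)), ?_⟩
      intro x hx y
      by_cases hxa : x = a
      · subst hxa
        cases h : f x y <;> simp [Protocol.eval, h]
      · have hxs : x ∈ s := by simpa [hxa] using hx
        simp [Protocol.eval, hxa, hπ x hxs y]
  obtain ⟨π, hπ⟩ := key Finset.univ
  exact ⟨π, fun x y => hπ x (Finset.mem_univ x) y⟩

theorem exists_computes_total {X Y : Type} [Finite X] (f : X → Y → Bool) :
    ∃ c : ℕ, ∃ μ : RandProtocol X Y, μ.CostLE c ∧ μ.Computes (ofTotal f) := by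
  obtain ⟨π, hπ⟩ := exists_protocol f
  refine ⟨π.cost, PMF.pure π, ?_, ?_⟩
  · intro π' h
    have : π' = π := by simpa using h
    rw [this]
  · intro x y b h
    have hb : f x y = b := by simpa [ofTotal] using h
    have h1 : RandProtocol.prob (PMF.pure π) x y b = 1 := by
      simp [RandProtocol.prob, PMF.pure_map, hπ, hb]
    rw [h1]
    exact ENNReal.div_le_of_le_mul (by norm_num)

theorem exists_isCompletion {X Y : Type} (g : PartialProblem X Y) :
    ∃ f : X → Y → Bool, IsCompletion g f :=
  ⟨fun x y => (g x y).getD false, fun x y b h => by simp [h]⟩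

theorem exists_pseudodetCC {X Y : Type} [Finite X] (g : PartialProblem X Y) :
    ∃ μ : RandProtocol X Y, μ.CostLE (pseudodetCC g) ∧ μ.ComputesPseudodet g := by
  obtain ⟨f, hf⟩ := exists_isCompletion g
  obtain ⟨c, μ, hc, hμ⟩ := exists_computes_total f
  exact Nat.sInf_mem
    (s := {c : ℕ | ∃ μ : RandProtocol X Y, μ.CostLE c ∧ μ.ComputesPseudodet g})
    ⟨c, μ, hc, f, hf, hμ⟩

theorem exists_randCC {X Y : Type} [Finite X] (g : PartialProblem X Y) :
    ∃ μ : RandProtocol X Y, μ.CostLE (randCC g) ∧ μ.Computes g := by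
  obtain ⟨f, hf⟩ := exists_isCompletion g
  obtain ⟨c, μ, hc, hμ⟩ := exists_computes_total f
  refine Nat.sInf_mem (s := {c : ℕ | ∃ μ : RandProtocol X Y, μ.CostLE c ∧ μ.Computes g})
    ⟨c, μ, hc, fun x y b h => hμ x y b ?_⟩
  simp [ofTotal, hf x y b h]

/-! ### Gap Majority composed with the inner product gadget -/

/-- The number of ones in a Boolean string. -/
def weight {n : ℕ} (z : Fin n → Bool) : ℕ := (Finset.univ.filter fun i => z i = true).card

/-- Gap Majority: `1` if `|z| ≥ (2/3) n`, `0` if `|z| ≤ (1/3) n`, and `*` otherwise. -/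
def gapMaj {n : ℕ} (z : Fin n → Bool) : Option Bool :=
  if 2 * n ≤ 3 * weight z then some true
  else if 3 * weight z ≤ n then some false
  else none

/-- The inner product modulo 2 of two `m`-bit strings. -/
def innerProd {m : ℕ} (a b : Fin m → Bool) : Bool :=
  decide ((∑ i, (a i).toNat * (b i).toNat) % 2 = 1)

/-- `GapMaj ∘ IP_m^n`. -/
def gapMajIP (n m : ℕ) : PartialProblem (Fin n → Fin m → Bool) (Fin n → Fin m → Bool) :=
  fun x y => gapMaj fun i => innerProd (x i) (y i)

/-- The gadget size `m = 100 log₂ n`, rounded up to an integer. -/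
noncomputable def gadgetSize (n : ℕ) : ℕ := ⌈100 * Real.logb 2 n⌉₊

/-- The largest number `n ≤ N` of gadgets of size `gadgetSize n` that fit into `N` bits. -/
noncomputable def blockCount (N : ℕ) : ℕ := Nat.findGreatest (fun n => n * gadgetSize n ≤ N) N

theorem blockCount_mul_le (N : ℕ) : blockCount N * gadgetSize (blockCount N) ≤ N :=
  Nat.findGreatest_spec (P := fun n => n * gadgetSize n ≤ N) (Nat.zero_le N) (by simp)

/-- Cut an `N`-bit string into `blockCount N` consecutive blocks of `gadgetSize (blockCount N)` bits
each, ignoring the remaining bits: bit `j` of block `i` is bit `i * gadgetSize (blockCount N) + j`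
of the string. -/
noncomputable def blocks {N : ℕ} (x : Fin N → Bool) :
    Fin (blockCount N) → Fin (gadgetSize (blockCount N)) → Bool :=
  fun i j => x (Fin.castLE (blockCount_mul_le N) (finProdFinEquiv (i, j)))

/-- The partial problem `{0,1}^N × {0,1}^N → {0,1,*}` obtained from `GapMaj ∘ IP_m^n`, where
`n = blockCount N` and `m = gadgetSize n`, by ignoring the superfluous input bits. -/
noncomputable def paddedGapMajIP (N : ℕ) : PartialProblem (Fin N → Bool) (Fin N → Bool) :=
  fun x y => gapMajIP (blockCount N) (gadgetSize (blockCount N)) (blocks x) (blocks y)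

end GapMajSep

namespace GapMajSep

open Finset

/-! ### Characters of the inner product -/

/-! The upper bounds are a sampling argument: under the promise, the gadget in a uniformly random
block has the correct value with probability at least 2/3, and evaluating one gadget takes m + 1
bits.

For the lower bound, let a protocol of cost q compute a completion f, and call slice k the set of
inputs on which exactly k gadgets are one. On slice ⌊n/3⌋ f is 0, and on slices k ≥ 2n/3 it is 1.
The proof carries the property "f is 0 on at least half of the slice" upwards in steps of length j =
⌊√n⌋ and reaches a contradiction if q is small. The invariant (`IsState`) lives on a rectangle in
which both players' blocks in U are constant and which is spread outside U. On such a rectangle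
Lindsey's lemma bounds every nontrivial character sum, so the free gadgets are nearly uniform
(`abs_sum_indicator_sub_le`) and slice sizes are binomial up to a factor 1 ± 1/10
(`IsRate.sliceCount_bounds`).

For one step, give slice k positive weight, and give errors (points where f = 1) in slices k and k +
j negative weight. If five independent runs must all reject, the expected weight stays positive,
because zeros of f survive far more often than errors. So some rectangle on which five deterministic
runs reject has weight at least 2^(-5q)/64. Density restoration (`exists_spread_subrectangle`)
passes to a spread subrectangle, still of positive weight. Positivity says that slice k + j has few
errors compared with slice k; since slice sizes are binomial, it has few compared with itself,
provided that the number r of newly fixed blocks satisfies j r ≲ n (`choose_mul_choose_le`,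
`IsState.advance`).

Accounting uses the deficiency, a nonnegative log-density. A step raises it by O(q), while each
newly fixed block lowers it by a constant times m. Starting from a state with the most fixed blocks
within budget forces r = O(q/m) (`exists_state_succ`). If q is below a small multiple of m√n, then r
is small against j, so j r ≲ n, and the O(√n) steps spend only a small fraction of m n in total,
which keeps U small throughout. -/

/-- The sign `(-1)^b` of a bit. -/
def sgn (b : Bool) : ℝ := if b then -1 else 1

lemma abs_sgn (b : Bool) : |sgn b| = 1 := by cases b <;> simp [sgn]

lemma one_add_sgn_mul_sgn (b c : Bool) :
    1 + sgn b * sgn c = if b = c then 2 else 0 := by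
  cases b <;> cases c <;> norm_num [sgn]

lemma sgn_innerProd {m : ℕ} (a b : Fin m → Bool) :
    sgn (innerProd a b) = ∏ l, sgn (a l && b l) := by
  have h1 : ∀ l, sgn (a l && b l) = (-1 : ℝ) ^ ((a l).toNat * (b l).toNat) := by
    intro l; cases a l <;> cases b l <;> simp [sgn]
  rw [prod_congr rfl fun l _ => h1 l, prod_pow_eq_pow_sum]
  rcases Nat.even_or_odd (∑ i, (a i).toNat * (b i).toNat) with h | h
  · have h2 : innerProd a b = false := by simp [innerProd, Nat.even_iff.mp h]
    rw [h.neg_one_pow, h2]; rfl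
  · have h2 : innerProd a b = true := by simp [innerProd, Nat.odd_iff.mp h]
    rw [h.neg_one_pow, h2]; rfl

lemma sum_sgn_innerProd_mul {m : ℕ} (b c : Fin m → Bool) :
    ∑ a, sgn (innerProd a b) * sgn (innerProd a c) = if b = c then 2 ^ m else 0 := by
  have h1 : ∀ a : Fin m → Bool, sgn (innerProd a b) * sgn (innerProd a c)
      = ∏ l, sgn (a l && b l) * sgn (a l && c l) := by
    intro a; rw [sgn_innerProd, sgn_innerProd, prod_mul_distrib]
  simp only [h1]
  have h2 := Finset.prod_univ_sum (fun _ : Fin m => (univ : Finset Bool))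
    (fun l e => sgn (e && b l) * sgn (e && c l))
  simp only [Fintype.piFinset_univ] at h2
  rw [← h2]
  have h3 : ∀ l, ∑ e : Bool, sgn (e && b l) * sgn (e && c l) = if b l = c l then 2 else 0 := by
    intro l; cases b l <;> cases c l <;> norm_num [sgn]
  simp only [h3]
  by_cases h : b = c
  · subst h; simp
  · rw [if_neg h]
    obtain ⟨l, hl⟩ := Function.ne_iff.mp h
    exact prod_eq_zero (mem_univ l) (if_neg hl)

/-! ### Spread sets -/

/-- The strings of `A` that agree with `a` on the coordinates in `T`. -/
def fiber {ι β : Type} [DecidableEq β] (A : Finset (ι → β)) (T : Finset ι) (a : ι → β) :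
    Finset (ι → β) := A.filter fun x => ∀ i ∈ T, x i = a i

lemma mem_fiber {ι β : Type} [DecidableEq β] {A : Finset (ι → β)} {T : Finset ι} {a x : ι → β} :
    x ∈ fiber A T a ↔ x ∈ A ∧ ∀ i ∈ T, x i = a i := by simp [fiber]

lemma fiber_empty {ι β : Type} [DecidableEq β] (A : Finset (ι → β)) (a : ι → β) :
    fiber A ∅ a = A := by simp [fiber]

/-- The marginals of `A` outside of `U` are spread: prescribing the coordinates in a set `T` disjoint
from `U` leaves at most `σ / Q ^ |T|` elements. -/
def Spread {ι β : Type} [DecidableEq β] (Q : ℝ) (U : Finset ι) (σ : ℝ) (A : Finset (ι → β)) : Prop :=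
  ∀ (T : Finset ι) (a : ι → β), Disjoint T U → ((fiber A T a).card : ℝ) * Q ^ T.card ≤ σ

/-- All elements of `A` agree on the coordinates in `U`. -/
def FixedOn {ι β : Type} (U : Finset ι) (A : Finset (ι → β)) : Prop :=
  ∀ x ∈ A, ∀ y ∈ A, ∀ i ∈ U, x i = y i

lemma FixedOn.mono {ι β : Type} {U : Finset ι} {A A' : Finset (ι → β)} (h : FixedOn U A)
    (hA : A' ⊆ A) : FixedOn U A' := fun x hx y hy => h x (hA hx) y (hA hy)

/-- Each pattern on S is attained at most M times in A, and F is nonnegative, so the sum over A may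
be enlarged to a sum over all patterns. Orthogonality of characters then becomes available. -/
lemma sum_le_of_fiber_card_le {ι β : Type} [DecidableEq ι] [DecidableEq β] [Fintype β]
    [Nonempty (ι → β)] {A : Finset (ι → β)} {S : Finset ι} {M : ℝ}
    (hM : ∀ a, ((fiber A S a).card : ℝ) ≤ M) (F : (S → β) → ℝ)
    (hF : ∀ u, 0 ≤ F u) :
    ∑ x ∈ A, F (fun i => x i) ≤ M * ∑ u, F u := by
  rw [← Finset.sum_fiberwise A (fun (x : ι → β) (i : S) => x i), Finset.mul_sum]
  refine sum_le_sum fun u _ => ?_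
  by_cases hne : (A.filter fun x => (fun i : S => x i) = u).Nonempty
  · obtain ⟨a, ha⟩ := hne
    have h1 : (A.filter fun x => (fun i : S => x i) = u) ⊆ fiber A S a := by
      intro x hx
      simp only [mem_filter] at hx ha
      refine mem_fiber.mpr ⟨hx.1, fun i hi => ?_⟩
      exact congrFun (hx.2.trans ha.2.symm) ⟨i, hi⟩
    calc _ = ∑ x ∈ A.filter fun x => (fun i : S => x i) = u, F u :=
          sum_congr rfl fun x hx => by rw [(mem_filter.mp hx).2]
      _ = ((A.filter fun x => (fun i : S => x i) = u).card : ℝ) * F u := by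
          rw [sum_const, nsmul_eq_mul]
      _ ≤ M * F u := by
          have h2 := hM a
          have h3 : (((A.filter fun x => (fun i : S => x i) = u).card : ℕ) : ℝ)
              ≤ (fiber A S a).card := by exact_mod_cast card_le_card h1
          exact mul_le_mul_of_nonneg_right (h3.trans h2) (hF u)
  · rw [Finset.not_nonempty_iff_eq_empty.mp hne, sum_empty]
    exact mul_nonneg ((Nat.cast_nonneg _).trans (hM Classical.ofNonempty)) (hF u)

lemma sum_prod_sgn_mul {n m : ℕ} (S : Finset (Fin n)) (y y' : Fin n → Fin m → Bool) :
    ∑ u : S → Fin m → Bool, (∏ i : S, sgn (innerProd (u i) (y i))) *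
        (∏ i : S, sgn (innerProd (u i) (y' i)))
      = if ∀ i ∈ S, y i = y' i then ((2 : ℝ) ^ m) ^ S.card else 0 := by
  simp only [← prod_mul_distrib]
  have h2 := Finset.prod_univ_sum (fun _ : S => (univ : Finset (Fin m → Bool)))
    (fun i e => sgn (innerProd e (y i)) * sgn (innerProd e (y' i)))
  simp only [Fintype.piFinset_univ, sum_sgn_innerProd_mul] at h2
  rw [← h2]
  by_cases h : ∀ i ∈ S, y i = y' i
  · rw [if_pos h, prod_congr rfl fun i _ => if_pos (h i.1 i.2)]
    simp
  · rw [if_neg h]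
    push Not at h
    obtain ⟨i, hi, hne⟩ := h
    exact prod_eq_zero (mem_univ (⟨i, hi⟩ : S)) (if_neg hne)

/-- Lindsey's lemma for spread rectangles. -/
lemma sq_sum_prod_sgn_le {n m : ℕ} {A B : Finset (Fin n → Fin m → Bool)} {S : Finset (Fin n)}
    {M M' : ℝ} (hA : ∀ a, ((fiber A S a).card : ℝ) ≤ M) (hB : ∀ a, ((fiber B S a).card : ℝ) ≤ M') :
    (∑ x ∈ A, ∑ y ∈ B, ∏ i ∈ S, sgn (innerProd (x i) (y i))) ^ 2
      ≤ A.card * M * (((2 : ℝ) ^ m) ^ S.card * (B.card * M')) := by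
  set F : (S → Fin m → Bool) → ℝ := fun u => ∑ y ∈ B, ∏ i : S, sgn (innerProd (u i) (y i)) with hF
  have h1 : ∀ x : Fin n → Fin m → Bool,
      ∑ y ∈ B, ∏ i ∈ S, sgn (innerProd (x i) (y i)) = F fun i => x i := by
    intro x
    refine sum_congr rfl fun y _ => ?_
    rw [← prod_coe_sort]
  simp only [h1]
  -- Cauchy–Schwarz over A, then enlargement to all patterns on S; orthogonality leaves only pairs
  -- y, y' that agree on S, which are counted by the fibers of B.
  have h2 : (∑ x ∈ A, F fun i => x i) ^ 2 ≤ A.card * ∑ x ∈ A, (F fun i => x i) ^ 2 :=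
    sq_sum_le_card_mul_sum_sq
  have h3 := sum_le_of_fiber_card_le hA (fun u => F u ^ 2) fun u => sq_nonneg _
  have h4 : ∑ u, F u ^ 2 ≤ ((2 : ℝ) ^ m) ^ S.card * (B.card * M') := by
    calc ∑ u, F u ^ 2 = ∑ u : S → Fin m → Bool, ∑ y ∈ B, ∑ y' ∈ B,
            (∏ i : S, sgn (innerProd (u i) (y i))) * ∏ i : S, sgn (innerProd (u i) (y' i)) := by
          refine sum_congr rfl fun u _ => ?_
          rw [hF, sq, sum_mul_sum]
      _ = ∑ y ∈ B, ∑ y' ∈ B, if ∀ i ∈ S, y i = y' i then ((2 : ℝ) ^ m) ^ S.card else 0 := by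
          rw [sum_comm]
          refine sum_congr rfl fun y _ => ?_
          rw [sum_comm]
          exact sum_congr rfl fun y' _ => sum_prod_sgn_mul S y y'
      _ = ∑ y ∈ B, ((fiber B S y).card : ℝ) * ((2 : ℝ) ^ m) ^ S.card := by
          refine sum_congr rfl fun y _ => ?_
          rw [← sum_filter, sum_const, nsmul_eq_mul]
          congr 3
          ext y'
          simp [mem_fiber, eq_comm]
      _ ≤ ∑ y ∈ B, M' * ((2 : ℝ) ^ m) ^ S.card := by
          gcongr with y hy
          exact hB y
      _ = _ := by rw [sum_const, nsmul_eq_mul]; ring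
  have hM : 0 ≤ M := (Nat.cast_nonneg _).trans (hA fun _ _ => false)
  calc _ ≤ _ := h2
    _ ≤ (A.card : ℝ) * (M * ∑ u, F u ^ 2) := by gcongr
    _ ≤ A.card * (M * (((2 : ℝ) ^ m) ^ S.card * (B.card * M'))) := by gcongr
    _ = _ := by ring

/-! ### The values of the gadgets on a spread rectangle -/

lemma sum_powerset_pow_card {ι : Type} (J : Finset ι) (η : ℝ) :
    ∑ S ∈ J.powerset, η ^ S.card = (1 + η) ^ J.card := by
  rw [← prod_const, prod_one_add]
  simp

lemma one_add_pow_sub_one_le {η δ : ℝ} {n k : ℕ} (hη : 0 ≤ η) (hn : n * η ≤ δ) (hδ : δ ≤ 1 / 2)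
    (hk : k ≤ n) : (1 + η) ^ k - 1 ≤ 2 * δ := by
  have h0 : (k : ℝ) * η ≤ δ := le_trans (by gcongr) hn
  have h1 : (1 + η) ^ k ≤ Real.exp (k * η) := by
    rw [Real.exp_nat_mul]
    gcongr
    linarith [Real.add_one_le_exp η]
  have h2 : Real.exp (k * η) ≤ 1 + (k * η) + (k * η) ^ 2 := by
    have := Real.abs_exp_sub_one_sub_id_le (x := k * η)
      (by rw [abs_of_nonneg (by positivity)]; linarith)
    linarith [(abs_le.mp this).2]
  have h3 : 0 ≤ (k : ℝ) * η := by positivity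
  nlinarith

/-- Fourier expansion: the indicator is the product over J of (1 + sgn ζᵢ · sgn zᵢ) / 2. -/
lemma indicator_eq_sum_sgn {n : ℕ} (J : Finset (Fin n)) (z ζ : Fin n → Bool) :
    (if ∀ i ∈ J, z i = ζ i then (1 : ℝ) else 0)
      = ((2 : ℝ) ^ J.card)⁻¹ * ∑ S ∈ J.powerset, (∏ i ∈ S, sgn (ζ i)) * ∏ i ∈ S, sgn (z i) := by
  simp only [← prod_mul_distrib]
  rw [← prod_one_add]
  by_cases h : ∀ i ∈ J, z i = ζ i
  · rw [if_pos h, prod_congr rfl fun i hi => by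
      rw [one_add_sgn_mul_sgn, if_pos (h i hi).symm]]
    simp
  · rw [if_neg h]
    push Not at h
    obtain ⟨i, hi, hne⟩ := h
    rw [prod_eq_zero hi (by rw [one_add_sgn_mul_sgn, if_neg (Ne.symm hne)]), mul_zero]

/-- On a spread rectangle the gadgets outside of `U` take all combinations of values about equally
often. -/
lemma abs_sum_indicator_sub_le {n m : ℕ} {A B : Finset (Fin n → Fin m → Bool)}
    {U : Finset (Fin n)} {Q η δ : ℝ} (hQ : 0 < Q) (hη : 0 ≤ η) (hQη : 2 ^ m ≤ η ^ 2 * Q ^ 2)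
    (hnη : n * η ≤ δ) (hδ : δ ≤ 1 / 2)
    (hA : Spread Q U (2 * A.card) A) (hB : Spread Q U (2 * B.card) B) (ζ : Fin n → Bool) :
    |(∑ x ∈ A, ∑ y ∈ B, if ∀ i ∈ Uᶜ, innerProd (x i) (y i) = ζ i then (1 : ℝ) else 0)
        - ((2 : ℝ) ^ (Uᶜ).card)⁻¹ * (A.card * B.card)|
      ≤ ((2 : ℝ) ^ (Uᶜ).card)⁻¹ * (A.card * B.card) * (4 * δ) := by
  set J := Uᶜ with hJ
  set C : Finset (Fin n) → ℝ := fun S =>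
    ∑ x ∈ A, ∑ y ∈ B, ∏ i ∈ S, sgn (innerProd (x i) (y i)) with hC
  have h1 : (∑ x ∈ A, ∑ y ∈ B, if ∀ i ∈ J, innerProd (x i) (y i) = ζ i then (1 : ℝ) else 0)
      = ((2 : ℝ) ^ J.card)⁻¹ * ∑ S ∈ J.powerset, (∏ i ∈ S, sgn (ζ i)) * C S := by
    simp only [hC, indicator_eq_sum_sgn, ← mul_sum]
    congr 1
    simp only [mul_sum]
    rw [sum_comm (s := J.powerset)]
    refine sum_congr rfl fun x _ => ?_
    rw [sum_comm]
  have hC0 : C ∅ = A.card * B.card := by simp [hC]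
  -- Lindsey's lemma with fiber bounds 2|A| / Q^|S| and 2|B| / Q^|S|; the assumption 2^m ≤ η² Q²
  -- turns the result into η^|S|.
  have hCS : ∀ S ∈ J.powerset, |C S| ≤ 2 * (A.card * B.card) * η ^ S.card := by
    intro S hS
    have hd : Disjoint S U := disjoint_left.mpr fun i hi hU => by
      have := mem_powerset.mp hS hi
      simp [hJ, hU] at this
    have hQs : 0 < Q ^ S.card := by positivity
    have hAM : ∀ a, ((fiber A S a).card : ℝ) ≤ 2 * A.card / Q ^ S.card := fun a => by
      rw [le_div_iff₀ hQs]; exact hA S a hd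
    have hBM : ∀ a, ((fiber B S a).card : ℝ) ≤ 2 * B.card / Q ^ S.card := fun a => by
      rw [le_div_iff₀ hQs]; exact hB S a hd
    have h2 := sq_sum_prod_sgn_le hAM hBM
    refine abs_le_of_sq_le_sq ?_ (by positivity)
    refine h2.trans ?_
    have h3 : ((2 : ℝ) ^ m) ^ S.card ≤ (η ^ 2 * Q ^ 2) ^ S.card := by gcongr
    calc _ = 4 * (A.card * B.card : ℝ) ^ 2 / (Q ^ S.card) ^ 2 * ((2 : ℝ) ^ m) ^ S.card := by
          field_simp; ring
      _ ≤ 4 * (A.card * B.card : ℝ) ^ 2 / (Q ^ S.card) ^ 2 * (η ^ 2 * Q ^ 2) ^ S.card := by gcongr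
      _ = _ := by field_simp; ring
  -- The empty set gives the main term; the other characters add up to at most a multiple of (1 +
  -- η)^|J| - 1.
  have h4 : ∑ S ∈ J.powerset, (∏ i ∈ S, sgn (ζ i)) * C S
      = A.card * B.card + ∑ S ∈ J.powerset.erase ∅, (∏ i ∈ S, sgn (ζ i)) * C S := by
    rw [← add_sum_erase _ _ (empty_mem_powerset J), hC0]
    simp
  have h5 : |∑ S ∈ J.powerset.erase ∅, (∏ i ∈ S, sgn (ζ i)) * C S|
      ≤ (A.card * B.card) * (4 * δ) := by
    calc _ ≤ ∑ S ∈ J.powerset.erase ∅, |(∏ i ∈ S, sgn (ζ i)) * C S| := abs_sum_le_sum_abs _ _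
      _ ≤ ∑ S ∈ J.powerset.erase ∅, 2 * (A.card * B.card) * η ^ S.card := by
          refine sum_le_sum fun S hS => ?_
          rw [abs_mul, abs_prod, prod_congr rfl fun i _ => abs_sgn (ζ i), prod_const_one, one_mul]
          exact hCS S (mem_of_mem_erase hS)
      _ = 2 * (A.card * B.card) * ((1 + η) ^ J.card - 1) := by
          rw [← mul_sum, ← sum_powerset_pow_card,
            ← add_sum_erase _ _ (empty_mem_powerset J)]
          simp
      _ ≤ 2 * (A.card * B.card) * (2 * δ) := by
          gcongr
          exact one_add_pow_sub_one_le hη hnη hδ (by simpa using card_le_univ J)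
      _ = _ := by ring
  rw [h1, h4, mul_add, add_sub_cancel_left, abs_mul, abs_of_pos (by positivity), mul_assoc]
  gcongr

/-- The string of gadget values. -/
def gadgets {n m : ℕ} (x y : Fin n → Fin m → Bool) : Fin n → Bool := fun i => innerProd (x i) (y i)

/-- The number of inputs in the rectangle `A × B` on which exactly `k` gadgets evaluate to one. -/
noncomputable def sliceCount {n m : ℕ} (k : ℕ) (A B : Finset (Fin n → Fin m → Bool)) : ℝ :=
  ∑ x ∈ A, ∑ y ∈ B, if weight (gadgets x y) = k then (1 : ℝ) else 0

lemma weight_eq_card_add_card {n : ℕ} (U : Finset (Fin n)) (z : Fin n → Bool) :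
    weight z = (U.filter fun i => z i = true).card + ((Uᶜ).filter fun i => z i = true).card := by
  rw [weight, ← card_union_of_disjoint, ← filter_union, union_compl]
  exact disjoint_filter_filter disjoint_compl_right

lemma card_filter_weight_eq {n : ℕ} (U : Finset (Fin n)) (z : Fin n → Bool) (κ : ℕ) :
    ((univ : Finset (Fin n → Bool)).filter fun ζ => (∀ i ∈ U, ζ i = z i) ∧
      weight ζ = κ + (U.filter fun i => z i = true).card).card = (Uᶜ).card.choose κ := by
  rw [← card_powersetCard]
  refine card_bij' (fun ζ _ => (Uᶜ).filter fun i => ζ i = true)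
    (fun T _ i => if i ∈ U then z i else decide (i ∈ T)) ?_ ?_ ?_ ?_
  · intro ζ hζ
    simp only [mem_filter, mem_univ, true_and] at hζ
    refine mem_powersetCard.mpr ⟨filter_subset _ _, ?_⟩
    have h1 := weight_eq_card_add_card U ζ
    have h2 : (U.filter fun i => ζ i = true) = U.filter fun i => z i = true :=
      filter_congr fun i hi => by rw [hζ.1 i hi]
    rw [h2] at h1
    omega
  · intro T hT
    obtain ⟨hTU, hc⟩ := mem_powersetCard.mp hT
    simp only [mem_filter, mem_univ, true_and]
    refine ⟨fun i hi => by simp [hi], ?_⟩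
    rw [weight_eq_card_add_card U, add_comm]
    congr 1
    · rw [← hc]
      congr 1
      ext i
      simp only [mem_filter, mem_compl]
      constructor
      · rintro ⟨h1, h2⟩; simpa [h1] using h2
      · intro h
        have := mem_compl.mp (hTU h)
        simp [this, h]
    · congr 1
      exact filter_congr fun i hi => by simp [hi]
  · intro ζ hζ
    simp only [mem_filter, mem_univ, true_and] at hζ
    funext i
    by_cases hi : i ∈ U
    · simp [hi, hζ.1 i hi]
    · simp [hi]
  · intro T hT
    obtain ⟨hTU, hc⟩ := mem_powersetCard.mp hT
    ext i
    simp only [mem_filter, mem_compl]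
    constructor
    · rintro ⟨h1, h2⟩; simpa [h1] using h2
    · intro h
      have := mem_compl.mp (hTU h)
      simp [this, h]

/-- The size of a slice of a spread rectangle. -/
lemma abs_sliceCount_sub_le {n m : ℕ} {A B : Finset (Fin n → Fin m → Bool)}
    {U : Finset (Fin n)} {Q η δ : ℝ} (hQ : 0 < Q) (hη : 0 ≤ η) (hQη : 2 ^ m ≤ η ^ 2 * Q ^ 2)
    (hnη : n * η ≤ δ) (hδ : δ ≤ 1 / 2)
    (hA : Spread Q U (2 * A.card) A) (hB : Spread Q U (2 * B.card) B)
    {z : Fin n → Bool} (hz : ∀ x ∈ A, ∀ y ∈ B, ∀ i ∈ U, gadgets x y i = z i) (κ : ℕ) :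
    |sliceCount (κ + (U.filter fun i => z i = true).card) A B
        - (Uᶜ).card.choose κ * ((2 : ℝ) ^ (Uᶜ).card)⁻¹ * (A.card * B.card)|
      ≤ (Uᶜ).card.choose κ * ((2 : ℝ) ^ (Uᶜ).card)⁻¹ * (A.card * B.card) * (4 * δ) := by
  set Z := (univ : Finset (Fin n → Bool)).filter fun ζ => (∀ i ∈ U, ζ i = z i) ∧
      weight ζ = κ + (U.filter fun i => z i = true).card with hZ
  have hZc : (Z.card : ℝ) = (Uᶜ).card.choose κ := by rw [hZ, card_filter_weight_eq]
  have h1 : sliceCount (κ + (U.filter fun i => z i = true).card) A B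
      = ∑ ζ ∈ Z, ∑ x ∈ A, ∑ y ∈ B,
        if ∀ i ∈ Uᶜ, innerProd (x i) (y i) = ζ i then (1 : ℝ) else 0 := by
    rw [sum_comm, sliceCount]
    refine sum_congr rfl fun x hx => ?_
    rw [sum_comm]
    refine sum_congr rfl fun y hy => ?_
    have h2 : ∀ ζ ∈ Z, (if ∀ i ∈ Uᶜ, innerProd (x i) (y i) = ζ i then (1 : ℝ) else 0)
        = if gadgets x y = ζ then 1 else 0 := by
      intro ζ hζ
      have hζ' := (mem_filter.mp hζ).2.1
      refine if_congr ⟨fun h => ?_, fun h i _ => congrFun h i⟩ rfl rfl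
      funext i
      by_cases hi : i ∈ U
      · rw [hζ' i hi, hz x hx y hy i hi]
      · exact h i (mem_compl.mpr hi)
    rw [sum_congr rfl h2, sum_ite_eq]
    refine if_congr ?_ rfl rfl
    simp only [hZ, mem_filter, mem_univ, true_and]
    exact ⟨fun h => ⟨hz x hx y hy, h⟩, fun h => h.2⟩
  rw [h1, ← hZc, mul_assoc, ← nsmul_eq_mul, ← sum_const, ← sum_sub_distrib]
  refine (abs_sum_le_sum_abs _ _).trans ?_
  rw [sum_mul]
  refine sum_le_sum fun ζ _ => ?_
  exact (abs_sum_indicator_sub_le hQ hη hQη hnη hδ hA hB ζ)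

/-! ### Density restoration -/

/-- The total weight of a rectangle. -/
def mass {X Y : Type} (H : X → Y → ℝ) (A : Finset X) (B : Finset Y) : ℝ :=
  ∑ x ∈ A, ∑ y ∈ B, H x y

lemma mass_swap {X Y : Type} (H : X → Y → ℝ) (A : Finset X) (B : Finset Y) :
    mass (fun y x => H x y) B A = mass H A B := sum_comm

lemma mass_empty_left {X Y : Type} (H : X → Y → ℝ) (B : Finset Y) : mass H ∅ B = 0 := sum_empty

lemma nonempty_of_mass_pos {X Y : Type} {H : X → Y → ℝ} {A : Finset X} {B : Finset Y}
    (h : 0 < mass H A B) : A.Nonempty ∧ B.Nonempty := by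
  constructor
  · by_contra h0
    rw [not_nonempty_iff_eq_empty.mp h0] at h
    simp [mass] at h
  · by_contra h0
    rw [not_nonempty_iff_eq_empty.mp h0] at h
    simp [mass] at h

section Restoration

set_option linter.unusedSectionVars false

variable {ι β : Type} [DecidableEq ι] [Fintype ι] [DecidableEq β] [Fintype β]

/-- The size of the fibers of `A` over supersets of `U`, weighted with powers of `Q`. -/
noncomputable def concentration (Q : ℝ) (U : Finset ι) (A : Finset (ι → β)) : ℝ :=
  ⨆ p : Finset ι × (ι → β),
    if Disjoint p.1 U then ((fiber A p.1 p.2).card : ℝ) * Q ^ (p.1.card + U.card) else 0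

lemma le_concentration (Q : ℝ) {U T : Finset ι} (A : Finset (ι → β)) (a : ι → β)
    (hT : Disjoint T U) :
    ((fiber A T a).card : ℝ) * Q ^ (T.card + U.card) ≤ concentration Q U A := by
  have := le_ciSup (Finite.bddAbove_range fun p : Finset ι × (ι → β) =>
    if Disjoint p.1 U then ((fiber A p.1 p.2).card : ℝ) * Q ^ (p.1.card + U.card) else 0) (T, a)
  rw [if_pos hT] at this
  exact this

lemma concentration_le {Q σ : ℝ} {U : Finset ι} {A : Finset (ι → β)} (hσ : 0 ≤ σ)
    (h : ∀ T a, Disjoint T U → a ∈ A → ((fiber A T a).card : ℝ) * Q ^ (T.card + U.card) ≤ σ) :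
    concentration Q U A ≤ σ := by
  refine Real.iSup_le (fun p => ?_) hσ
  split_ifs with hp
  · rcases (fiber A p.1 p.2).eq_empty_or_nonempty with h0 | ⟨x, hx⟩
    · simpa [h0] using hσ
    · obtain ⟨hxA, hx⟩ := mem_fiber.mp hx
      have : fiber A p.1 p.2 = fiber A p.1 x := by
        ext y
        simp only [mem_fiber]
        exact and_congr_right fun _ => forall₂_congr fun i hi => by rw [hx i hi]
      rw [this]
      exact h p.1 x hp hxA
  · exact hσ

lemma card_mul_le_concentration (Q : ℝ) (U : Finset ι) (A : Finset (ι → β)) :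
    (A.card : ℝ) * Q ^ U.card ≤ concentration Q U A := by
  rcases A.eq_empty_or_nonempty with h | ⟨a, -⟩
  · subst h
    simp only [card_empty, Nat.cast_zero, zero_mul]
    refine Real.iSup_nonneg fun p => ?_
    simp [fiber]
  · simpa [fiber_empty] using le_concentration Q A a (disjoint_empty_left U)

lemma concentration_nonneg {Q : ℝ} (hQ : 0 < Q) (U : Finset ι) (A : Finset (ι → β)) :
    0 ≤ concentration Q U A := le_trans (by positivity) (card_mul_le_concentration Q U A)

lemma concentration_pos {Q : ℝ} (hQ : 0 < Q) (U : Finset ι) {A : Finset (ι → β)}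
    (hA : A.Nonempty) : 0 < concentration Q U A := by
  have : 0 < A.card := hA.card_pos
  exact lt_of_lt_of_le (by positivity) (card_mul_le_concentration Q U A)

/-- A fiber of A' over S lies in a fiber of A over S ∪ T, because A' is constant on T. The exponent
|T| + |U| in `concentration` is chosen so that both fibers carry the same power of Q. -/
lemma concentration_le_of_fixedOn {Q : ℝ} (hQ : 0 < Q) {U T : Finset ι} {A A' : Finset (ι → β)}
    (hA : A' ⊆ A) (hT : Disjoint T U) (hfix : FixedOn T A') :
    concentration Q (U ∪ T) A' ≤ concentration Q U A := by
  refine concentration_le (concentration_nonneg hQ U A) fun S a hS ha => ?_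
  rw [disjoint_union_right] at hS
  have h1 : fiber A' S a ⊆ fiber A (S ∪ T) a := by
    intro x hx
    obtain ⟨hx1, hx2⟩ := mem_fiber.mp hx
    refine mem_fiber.mpr ⟨hA hx1, fun i hi => ?_⟩
    rcases mem_union.mp hi with h | h
    · exact hx2 i h
    · exact hfix x hx1 a ha i h
  have h2 : (fiber A' S a).card ≤ (fiber A (S ∪ T) a).card := card_le_card h1
  refine le_trans ?_ (le_concentration Q A a (disjoint_union_left.mpr ⟨hS.1, hT⟩))
  rw [card_union_of_disjoint hT.symm, card_union_of_disjoint hS.2,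
    show S.card + (U.card + T.card) = S.card + T.card + U.card by ring]
  gcongr

lemma concentration_mono {Q : ℝ} (hQ : 0 < Q) (U : Finset ι) {A A' : Finset (ι → β)}
    (hA : A' ⊆ A) : concentration Q U A' ≤ concentration Q U A := by
  simpa using concentration_le_of_fixedOn hQ hA (disjoint_empty_left U)
    (fun x _ y _ i hi => by simp at hi)

lemma spread_of_concentration_le {Q σ : ℝ} (hQ : 0 < Q) {U : Finset ι} {A : Finset (ι → β)}
    (h : concentration Q U A ≤ σ * Q ^ U.card) : Spread Q U σ A := by
  intro T a hT
  have h1 := (le_concentration Q A a hT).trans h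
  rw [pow_add, ← mul_assoc] at h1
  exact le_of_mul_le_mul_right h1 (by positivity)

lemma Spread.concentration_le {Q σ : ℝ} (hQ : 0 < Q) {U : Finset ι} {A : Finset (ι → β)}
    (hσ : 0 ≤ σ) (h : Spread Q U σ A) : concentration Q U A ≤ σ * Q ^ U.card := by
  refine GapMajSep.concentration_le (by positivity) fun T a hT _ => ?_
  rw [pow_add, ← mul_assoc]
  exact mul_le_mul_of_nonneg_right (h T a hT) (by positivity)

/-- No subrectangle of `A × B`, with possibly more fixed coordinates, has a better trade-off between
weight, number of fixed coordinates and concentration. -/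
def IsOptimal (Q w : ℝ) (H : (ι → β) → (ι → β) → ℝ) (A B : Finset (ι → β)) (U : Finset ι) : Prop :=
  ∀ A' B' U', A' ⊆ A → B' ⊆ B → U ⊆ U' → FixedOn U' A' → FixedOn U' B' → 0 < mass H A' B' →
    (mass H A' B' * w ^ U'.card) ^ 4 * (concentration Q U A * concentration Q U B)
      ≤ (mass H A B * w ^ U.card) ^ 4 * (concentration Q U' A' * concentration Q U' B')

lemma IsOptimal.swap {Q w : ℝ} {H : (ι → β) → (ι → β) → ℝ} {A B : Finset (ι → β)} {U : Finset ι}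
    (h : IsOptimal Q w H A B U) : IsOptimal Q w (fun x y => H y x) B A U := by
  intro B' A' U' hB hA hU hfB hfA hm
  rw [mass_swap H] at hm
  rw [mass_swap H, mass_swap H, mul_comm (concentration Q U B), mul_comm (concentration Q U' B')]
  exact h A' B' U' hA hB hU hfA hfB hm

/-- Fixing T does not increase either concentration, so optimality can only be respected if the
weight drops by the factor w^|T|. As H is signed, a piece of nonpositive weight is treated
separately. -/
lemma IsOptimal.mass_mul_pow_le {Q w : ℝ} (hQ : 0 < Q) (hw : 0 < w)
    {H : (ι → β) → (ι → β) → ℝ} {A B : Finset (ι → β)}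
    {U : Finset ι} (h : IsOptimal Q w H A B U) (hm : 0 < mass H A B)
    (hfA : FixedOn U A) (hfB : FixedOn U B) {A' B' : Finset (ι → β)} {T : Finset ι}
    (hA : A' ⊆ A) (hB : B' ⊆ B) (hT : Disjoint T U) (hTA : FixedOn T A') (hTB : FixedOn T B') :
    mass H A' B' * w ^ T.card ≤ mass H A B := by
  rcases le_or_gt (mass H A' B') 0 with hm' | hm'
  · exact (mul_nonpos_of_nonpos_of_nonneg hm' (by positivity)).trans hm.le
  have hne := nonempty_of_mass_pos hm'
  have hunion : ∀ {C C' : Finset (ι → β)}, C' ⊆ C → FixedOn U C → FixedOn T C' →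
      FixedOn (U ∪ T) C' := by
    intro C C' hC h1 h2 x hx y hy i hi
    rcases mem_union.mp hi with h | h
    · exact h1 x (hC hx) y (hC hy) i h
    · exact h2 x hx y hy i h
  have h1 := h A' B' (U ∪ T) hA hB subset_union_left (hunion hA hfA hTA) (hunion hB hfB hTB) hm'
  have hcA := concentration_pos hQ U (hne.1.mono hA)
  have hcB := concentration_pos hQ U (hne.2.mono hB)
  have h2 : concentration Q (U ∪ T) A' * concentration Q (U ∪ T) B'
      ≤ concentration Q U A * concentration Q U B := by
    have := concentration_nonneg hQ (U ∪ T) B'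
    gcongr
    · exact concentration_le_of_fixedOn hQ hA hT hTA
    · exact concentration_le_of_fixedOn hQ hB hT hTB
  have h3 : (mass H A' B' * w ^ (U ∪ T).card) ^ 4 ≤ (mass H A B * w ^ U.card) ^ 4 := by
    refine le_of_mul_le_mul_right (h1.trans ?_) (mul_pos hcA hcB)
    gcongr
  have h4 := le_of_pow_le_pow_left₀ (by norm_num) (by positivity) h3
  rw [card_union_of_disjoint hT.symm, pow_add, mul_comm (w ^ U.card), ← mul_assoc] at h4
  exact le_of_mul_le_mul_right h4 (by positivity)

lemma mass_fiberwise (H : (ι → β) → (ι → β) → ℝ) (A B : Finset (ι → β)) (T : Finset ι) :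
    mass H A B = ∑ u : T → β, ∑ v : T → β,
      mass H (A.filter fun x => (fun i : T => x i) = u) (B.filter fun y => (fun i : T => y i) = v) := by
  simp only [mass]
  rw [← sum_fiberwise A (fun (x : ι → β) (i : T) => x i) fun x => ∑ y ∈ B, H x y]
  refine sum_congr rfl fun u _ => ?_
  exact (sum_congr rfl fun x _ =>
    (sum_fiberwise B (fun (y : ι → β) (i : T) => y i) fun y => H x y).symm).trans sum_comm

lemma fixedOn_filter_restrict (A : Finset (ι → β)) (T : Finset ι) (u : T → β) :
    FixedOn T (A.filter fun x => (fun i : T => x i) = u) := by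
  intro x hx y hy i hi
  have h1 := (mem_filter.mp hx).2
  have h2 := (mem_filter.mp hy).2
  exact congrFun (h1.trans h2.symm) ⟨i, hi⟩

/-- The weight of the part of a rectangle that sits in heavy fibers over `T`. -/
lemma IsOptimal.mass_heavy_le {Q w : ℝ} (hQ : 0 < Q) (hw : 0 < w)
    {H : (ι → β) → (ι → β) → ℝ} {A B : Finset (ι → β)}
    {U : Finset ι} (h : IsOptimal Q w H A B U) (hm : 0 < mass H A B)
    (hfA : FixedOn U A) (hfB : FixedOn U B)
    (hlarge : 2 * A.card * Q ^ U.card < concentration Q U A) {A' : Finset (ι → β)} {T : Finset ι}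
    (hA : A' ⊆ A) (hT : Disjoint T U)
    (hheavy : ∀ x ∈ A', concentration Q U A < 2 * ((fiber A T x).card * Q ^ (T.card + U.card))) :
    mass H A' B ≤ mass H A B * ((Fintype.card β : ℝ) * Q / w) ^ T.card := by
  set σ := concentration Q U A with hσdef
  have hσ : 0 < σ := lt_of_le_of_lt (by positivity) hlarge
  set c : (T → β) → ℝ := fun u => ((A.filter fun x => (fun i : T => x i) = u).card : ℝ) with hc
  have hcsum : ∑ u, c u = A.card := by
    rw [hc, ← Nat.cast_sum, ← card_eq_sum_card_fiberwise fun x _ => mem_univ _]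
  -- The last factor is at least 1 when the u-piece is nonempty, since its fiber is then heavy.
  -- Summed over u it counts the heavy fibers, at most Q^|T| of them; the sum over v contributes
  -- |β|^|T|.
  have hpiece : ∀ u v : T → β,
      mass H (A'.filter fun x => (fun i : T => x i) = u) (B.filter fun y => (fun i : T => y i) = v)
        ≤ mass H A B / w ^ T.card * (2 * (c u * Q ^ (T.card + U.card)) / σ) := by
    intro u v
    rcases (A'.filter fun x => (fun i : T => x i) = u).eq_empty_or_nonempty with h0 | ⟨x, hx⟩
    · rw [h0]
      have hcu : 0 ≤ c u := Nat.cast_nonneg _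
      rw [mass_empty_left]
      positivity
    · have h1 := h.mass_mul_pow_le hQ hw hm hfA hfB ((filter_subset _ _).trans hA)
        (filter_subset _ _) hT (fixedOn_filter_restrict A' T u) (fixedOn_filter_restrict B T v)
      rw [← le_div_iff₀ (by positivity)] at h1
      refine h1.trans (le_mul_of_one_le_right (by positivity) ?_)
      obtain ⟨hxA, hxu⟩ := mem_filter.mp hx
      have h2 : c u = (fiber A T x).card := by
        have h3 : (A.filter fun x => (fun i : T => x i) = u) = fiber A T x := by
          ext y
          rw [mem_filter, mem_fiber, ← hxu]
          refine and_congr_right fun _ => ⟨fun h i hi => congrFun h ⟨i, hi⟩, fun h => ?_⟩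
          funext i
          exact h i i.2
        exact congrArg (fun s => (s.card : ℝ)) h3
      rw [h2, one_le_div hσ]
      exact (hheavy x hxA).le
  calc mass H A' B ≤ ∑ u : T → β, ∑ v : T → β,
        mass H A B / w ^ T.card * (2 * (c u * Q ^ (T.card + U.card)) / σ) := by
        rw [mass_fiberwise H A' B T]
        exact sum_le_sum fun u _ => sum_le_sum fun v _ => hpiece u v
    _ = mass H A B * ((Fintype.card β : ℝ) * Q / w) ^ T.card
          * (2 * A.card * Q ^ U.card / σ) := by
        simp only [sum_const, card_univ, Fintype.card_fun, Fintype.card_coe, nsmul_eq_mul,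
          ← mul_sum, ← sum_div, ← sum_mul, hcsum, Nat.cast_pow]
        rw [div_pow, mul_pow, pow_add]
        field_simp
    _ ≤ _ := by
        refine mul_le_of_le_one_right (by positivity) ?_
        rw [div_le_one hσ]
        exact hlarge.le

/-- If the concentration exceeded twice its trivial lower bound, deleting all points in heavy fibers
would cost at most 1/8 of the weight and halve the concentration. This improves the score because
(7/8)^4 > 1/2, which is why the weight enters `IsOptimal` with exponent 4. -/
lemma IsOptimal.concentration_le {Q w : ℝ} (hQ : 0 < Q) (hw : 0 < w)
    (hwn : 16 * Fintype.card ι * ((Fintype.card β : ℝ) * Q) ≤ w)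
    {H : (ι → β) → (ι → β) → ℝ} {A B : Finset (ι → β)}
    {U : Finset ι} (h : IsOptimal Q w H A B U) (hm : 0 < mass H A B)
    (hfA : FixedOn U A) (hfB : FixedOn U B) :
    concentration Q U A ≤ 2 * A.card * Q ^ U.card := by
  by_contra! hlarge
  set σ := concentration Q U A with hσdef
  have hσ : 0 < σ := lt_of_le_of_lt (by positivity) hlarge
  set ξ := (Fintype.card β : ℝ) * Q / w with hξ
  have hξ0 : 0 ≤ ξ := by positivity
  classical
  set light : (ι → β) → Prop := fun x => ∀ T, Disjoint T U →
    2 * ((fiber A T x).card * Q ^ (T.card + U.card)) ≤ σ with hlight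
  have hτ : ∀ x, ∃ T, ¬ light x → Disjoint T U ∧
      σ < 2 * ((fiber A T x).card * Q ^ (T.card + U.card)) := by
    intro x
    by_cases hx : light x
    · exact ⟨∅, fun h => absurd hx h⟩
    · have := hx
      simp only [hlight] at this
      push Not at this
      obtain ⟨T, hT⟩ := this
      exact ⟨T, fun _ => hT⟩
  choose τ hτ using hτ
  have hsplit : mass H A B = mass H (A.filter light) B + mass H (A.filter fun x => ¬ light x) B :=
    (sum_filter_add_sum_filter_not A light _).symm
  have hheavy : mass H (A.filter fun x => ¬ light x) B ≤ mass H A B * (1 / 8) := by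
    -- The heavy points are partitioned by one chosen witness set τ x. It is never empty: the fiber
    -- over ∅ is A itself, which is not heavy by assumption.
    have h1 : mass H (A.filter fun x => ¬ light x) B = ∑ T ∈ (Uᶜ).powerset.erase ∅,
        mass H ((A.filter fun x => ¬ light x).filter fun x => τ x = T) B := by
      refine (sum_fiberwise_of_maps_to (fun x hx => ?_) _).symm
      obtain ⟨hxA, hx⟩ := mem_filter.mp hx
      obtain ⟨hd, hlt⟩ := hτ x hx
      refine mem_erase.mpr ⟨fun h0 => ?_, mem_powerset.mpr ?_⟩
      · rw [h0, fiber_empty] at hlt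
        simp only [card_empty, zero_add] at hlt
        linarith
      · exact subset_compl_iff_disjoint_right.mpr hd
    rw [h1]
    calc _ ≤ ∑ T ∈ (Uᶜ).powerset.erase ∅, mass H A B * ξ ^ T.card := by
          refine sum_le_sum fun T hT => ?_
          refine h.mass_heavy_le hQ hw hm hfA hfB hlarge
            ((filter_subset _ _).trans (filter_subset _ _)) ?_ ?_
          · exact subset_compl_iff_disjoint_right.mp (mem_powerset.mp (mem_of_mem_erase hT))
          · intro x hx
            obtain ⟨hx1, rfl⟩ := mem_filter.mp hx
            exact (hτ x (mem_filter.mp hx1).2).2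
      _ = mass H A B * ((1 + ξ) ^ (Uᶜ).card - 1) := by
          rw [← mul_sum, ← sum_powerset_pow_card, ← add_sum_erase _ _ (empty_mem_powerset _)]
          simp
      _ ≤ mass H A B * (2 * (1 / 16)) := by
          gcongr
          refine one_add_pow_sub_one_le hξ0 ?_ (by norm_num) (card_le_univ _)
          rw [hξ, ← mul_div_assoc, div_le_iff₀ hw]
          linarith
      _ = _ := by ring
  have hm0 : mass H A B * (7 / 8) ≤ mass H (A.filter light) B := by linarith
  have hm0' : 0 < mass H (A.filter light) B := lt_of_lt_of_le (by positivity) hm0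
  have hB := (nonempty_of_mass_pos hm).2
  have h2 := h _ B U (filter_subset light A) subset_rfl subset_rfl
    (hfA.mono (filter_subset _ _)) hfB hm0'
  have hc : concentration Q U (A.filter light) ≤ σ / 2 := by
    refine GapMajSep.concentration_le (by positivity) fun T a hT ha => ?_
    have h3 := (mem_filter.mp ha).2 T hT
    have h4 : (fiber (A.filter light) T a).card ≤ (fiber A T a).card :=
      card_le_card fun y hy =>
        mem_fiber.mpr ⟨filter_subset _ _ (mem_fiber.mp hy).1, (mem_fiber.mp hy).2⟩
    have h5 : ((fiber (A.filter light) T a).card : ℝ) * Q ^ (T.card + U.card)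
        ≤ (fiber A T a).card * Q ^ (T.card + U.card) := by gcongr
    linarith
  have hσB := concentration_pos hQ U hB
  have h6 : (mass H A B * (7 / 8) * w ^ U.card) ^ 4 * (σ * concentration Q U B)
      ≤ (mass H A B * w ^ U.card) ^ 4 * (σ / 2 * concentration Q U B) := by
    calc _ ≤ (mass H (A.filter light) B * w ^ U.card) ^ 4 * (σ * concentration Q U B) := by
          gcongr
      _ ≤ _ := h2
      _ ≤ _ := by gcongr
  have h7 : 0 < (mass H A B * w ^ U.card) ^ 4 * (σ * concentration Q U B) := by positivity
  nlinarith

/-- Every rectangle of positive weight contains a rectangle that is spread outside of its fixed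
coordinates and whose weight is not much smaller. -/
theorem exists_spread_subrectangle {Q w : ℝ} (hQ : 0 < Q) (hw : 0 < w)
    (hwn : 16 * Fintype.card ι * ((Fintype.card β : ℝ) * Q) ≤ w)
    {H : (ι → β) → (ι → β) → ℝ} {A₀ B₀ : Finset (ι → β)} {I : Finset ι}
    (hm : 0 < mass H A₀ B₀) (hfA : FixedOn I A₀) (hfB : FixedOn I B₀) :
    ∃ A B U, A ⊆ A₀ ∧ B ⊆ B₀ ∧ I ⊆ U ∧ FixedOn U A ∧ FixedOn U B ∧ 0 < mass H A B ∧
      Spread Q U (2 * A.card) A ∧ Spread Q U (2 * B.card) B ∧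
      (mass H A₀ B₀ * w ^ I.card) ^ 4 * ((A.card * Q ^ U.card) * (B.card * Q ^ U.card))
        ≤ (mass H A B * w ^ U.card) ^ 4 * (concentration Q I A₀ * concentration Q I B₀) := by
  classical
  set F : Finset (Finset (ι → β) × Finset (ι → β) × Finset ι) :=
    univ.filter fun p => p.1 ⊆ A₀ ∧ p.2.1 ⊆ B₀ ∧ I ⊆ p.2.2 ∧ FixedOn p.2.2 p.1 ∧
      FixedOn p.2.2 p.2.1 ∧ 0 < mass H p.1 p.2.1 with hF
  -- Comparing the maximizer with its own subrectangles gives optimality; comparing it with the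
  -- initial triple gives the size bound.
  obtain ⟨⟨A, B, U⟩, hmem, hmax⟩ := F.exists_max_image
    (fun p => (mass H p.1 p.2.1 * w ^ p.2.2.card) ^ 4
      / (concentration Q p.2.2 p.1 * concentration Q p.2.2 p.2.1))
    ⟨(A₀, B₀, I), by simp [hF, hm, hfA, hfB]⟩
  simp only [hF, mem_filter, mem_univ, true_and] at hmem
  obtain ⟨hA, hB, hU, hfixA, hfixB, hpos⟩ := hmem
  have hcA := concentration_pos hQ U (nonempty_of_mass_pos hpos).1
  have hcB := concentration_pos hQ U (nonempty_of_mass_pos hpos).2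
  have hkey : ∀ A' B' U', A' ⊆ A₀ → B' ⊆ B₀ → I ⊆ U' → FixedOn U' A' → FixedOn U' B' →
      0 < mass H A' B' →
      (mass H A' B' * w ^ U'.card) ^ 4 * (concentration Q U A * concentration Q U B)
        ≤ (mass H A B * w ^ U.card) ^ 4 * (concentration Q U' A' * concentration Q U' B') := by
    intro A' B' U' h1 h2 h3 h4 h5 h6
    have hcA' := concentration_pos hQ U' (nonempty_of_mass_pos h6).1
    have hcB' := concentration_pos hQ U' (nonempty_of_mass_pos h6).2
    have := hmax (A', B', U') (by simp [hF, h1, h2, h3, h4, h5, h6])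
    rw [div_le_div_iff₀ (by positivity) (by positivity)] at this
    exact this
  have hopt : IsOptimal Q w H A B U := fun A' B' U' h1 h2 h3 =>
    hkey A' B' U' (h1.trans hA) (h2.trans hB) (hU.trans h3)
  refine ⟨A, B, U, hA, hB, hU, hfixA, hfixB, hpos, ?_, ?_, ?_⟩
  · exact spread_of_concentration_le hQ (hopt.concentration_le hQ hw hwn hpos hfixA hfixB)
  · exact spread_of_concentration_le hQ (hopt.swap.concentration_le hQ hw hwn
      (by rwa [mass_swap]) hfixB hfixA)
  · refine le_trans ?_ (hkey A₀ B₀ I subset_rfl subset_rfl subset_rfl hfA hfB hm)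
    gcongr
    · exact card_mul_le_concentration Q U A
    · exact card_mul_le_concentration Q U B

end Restoration

/-! ### Leaves of protocols -/

/-- Keep the heavier of the two parts. Nonnegative weights are needed to raise both exponents to
their maximum. -/
lemma exists_subrectangle_of_split {X Y : Type} {H : X → Y → ℝ} {A A₁ A₂ : Finset X}
    {B B₁ B₂ : Finset Y} {s s₁ s₂ : ℝ} {c₁ c₂ : ℕ} (hA₁ : A₁ ⊆ A) (hA₂ : A₂ ⊆ A)
    (hB₁ : B₁ ⊆ B) (hB₂ : B₂ ⊆ B) (h₁ : 0 ≤ mass H A₁ B₁) (h₂ : 0 ≤ mass H A₂ B₂)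
    (hs₁ : s₁ ≤ 2 ^ c₁ * mass H A₁ B₁) (hs₂ : s₂ ≤ 2 ^ c₂ * mass H A₂ B₂) (hs : s = s₁ + s₂) :
    ∃ A' B', A' ⊆ A ∧ B' ⊆ B ∧ 0 ≤ mass H A' B' ∧ s ≤ 2 ^ (max c₁ c₂ + 1) * mass H A' B' := by
  have e₁ : (2 : ℝ) ^ c₁ ≤ 2 ^ max c₁ c₂ := pow_le_pow_right₀ (by norm_num) (le_max_left _ _)
  have e₂ : (2 : ℝ) ^ c₂ ≤ 2 ^ max c₁ c₂ := pow_le_pow_right₀ (by norm_num) (le_max_right _ _)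
  have hs₁' := hs₁.trans (mul_le_mul_of_nonneg_right e₁ h₁)
  have hs₂' := hs₂.trans (mul_le_mul_of_nonneg_right e₂ h₂)
  have hp : (0 : ℝ) ≤ 2 ^ max c₁ c₂ := by positivity
  rcases le_total (mass H A₁ B₁) (mass H A₂ B₂) with h | h
  · refine ⟨A₂, B₂, hA₂, hB₂, h₂, ?_⟩
    have := mul_le_mul_of_nonneg_left h hp
    rw [pow_succ]
    linarith
  · refine ⟨A₁, B₁, hA₁, hB₁, h₁, ?_⟩
    have := mul_le_mul_of_nonneg_left h hp
    rw [pow_succ]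
    linarith

/-- Among the leaves of a protocol that are labelled `false`, one carries its share of the weight. -/
lemma Protocol.exists_leaf {X Y : Type} (H : X → Y → ℝ) (π : Protocol X Y) (A : Finset X)
    (B : Finset Y) :
    ∃ A' B', A' ⊆ A ∧ B' ⊆ B ∧ 0 ≤ mass H A' B' ∧
      mass (fun x y => if π.eval x y = false then H x y else 0) A B
        ≤ 2 ^ π.cost * mass H A' B' := by
  induction π generalizing A B with
  | output b =>
    cases b
    · rcases le_total 0 (mass H A B) with h | h
      · exact ⟨A, B, subset_rfl, subset_rfl, h, by simp [Protocol.eval, Protocol.cost]⟩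
      · exact ⟨∅, B, empty_subset _, subset_rfl, by simp [mass],
          by simpa [Protocol.eval, mass] using h⟩
    · exact ⟨∅, B, empty_subset _, subset_rfl, by simp [mass], by simp [mass, Protocol.eval]⟩
  | alice msg l r ihl ihr =>
    obtain ⟨A₁, B₁, hA₁, hB₁, h₁, hs₁⟩ := ihl (A.filter fun x => ¬ msg x = true) B
    obtain ⟨A₂, B₂, hA₂, hB₂, h₂, hs₂⟩ := ihr (A.filter fun x => msg x = true) B
    refine exists_subrectangle_of_split (hA₁.trans (filter_subset _ _))
      (hA₂.trans (filter_subset _ _)) hB₁ hB₂ h₁ h₂ hs₁ hs₂ ?_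
    rw [mass, ← sum_filter_not_add_sum_filter A (fun x => msg x = true)]
    congr 1
    · refine sum_congr rfl fun x hx => sum_congr rfl fun y _ => ?_
      simp only [Protocol.eval, Bool.eq_false_of_not_eq_true (mem_filter.mp hx).2, cond_false]
    · refine sum_congr rfl fun x hx => sum_congr rfl fun y _ => ?_
      simp only [Protocol.eval, (mem_filter.mp hx).2, cond_true]
  | bob msg l r ihl ihr =>
    obtain ⟨A₁, B₁, hA₁, hB₁, h₁, hs₁⟩ := ihl A (B.filter fun y => ¬ msg y = true)
    obtain ⟨A₂, B₂, hA₂, hB₂, h₂, hs₂⟩ := ihr A (B.filter fun y => msg y = true)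
    refine exists_subrectangle_of_split hA₁ hA₂ (hB₁.trans (filter_subset _ _))
      (hB₂.trans (filter_subset _ _)) h₁ h₂ hs₁ hs₂ ?_
    rw [mass, mass, mass, ← sum_add_distrib]
    refine sum_congr rfl fun x _ => ?_
    rw [← sum_filter_not_add_sum_filter B (fun y => msg y = true)]
    congr 1
    · refine sum_congr rfl fun y hy => ?_
      simp only [Protocol.eval, Bool.eq_false_of_not_eq_true (mem_filter.mp hy).2, cond_false]
    · refine sum_congr rfl fun y hy => ?_
      simp only [Protocol.eval, (mem_filter.mp hy).2, cond_true]

/-! ### Averaging over the random coins. -/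

lemma PMF.map_apply_toReal {α β : Type} [Fintype α] [DecidableEq β] (p : PMF α) (g : α → β)
    (b : β) : ((p.map g) b).toReal = ∑ a, (p a).toReal * if g a = b then 1 else 0 := by
  classical
  rw [PMF.map_apply, tsum_fintype, ENNReal.toReal_sum]
  · refine sum_congr rfl fun a _ => ?_
    by_cases h : g a = b
    · simp [h]
    · simp [h, Ne.symm h]
  · intro a _
    split_ifs
    · exact p.apply_ne_top a
    · simp

lemma PMF.sum_toReal {α : Type} [Fintype α] (p : PMF α) : ∑ a, (p a).toReal = 1 := by
  rw [← ENNReal.toReal_sum fun a _ => p.apply_ne_top a, ← tsum_fintype (L := .unconditional _),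
    p.tsum_coe]
  simp

lemma PMF.exists_mem_support_le {α : Type} [Fintype α] (p : PMF α) (v : α → ℝ) :
    ∃ a ∈ p.support, ∑ a, (p a).toReal * v a ≤ v a := by
  by_contra! h
  set s := ∑ a, (p a).toReal * v a with hs
  obtain ⟨a₀, ha₀⟩ := p.support_nonempty
  have hpos : ∀ a ∈ p.support, 0 < (p a).toReal := fun a ha =>
    ENNReal.toReal_pos ((p.mem_support_iff a).mp ha) (p.apply_ne_top a)
  have h1 : ∑ a, (p a).toReal * v a < ∑ a, (p a).toReal * s := by
    refine sum_lt_sum (fun a _ => ?_) ⟨a₀, mem_univ _, ?_⟩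
    · by_cases ha : a ∈ p.support
      · exact mul_le_mul_of_nonneg_left (h a ha).le ENNReal.toReal_nonneg
      · rw [p.mem_support_iff, not_not] at ha
        simp [ha]
    · exact mul_lt_mul_of_pos_left (h a₀ ha₀) (hpos a₀ ha₀)
  rw [← sum_mul, PMF.sum_toReal, one_mul] at h1
  exact lt_irrefl _ h1

/-- The probability, as a real number, that the protocol outputs `false`. -/
noncomputable def RandProtocol.rejectProb {X Y : Type} (μ : RandProtocol X Y) (x : X) (y : Y) : ℝ :=
  (μ.prob x y false).toReal

lemma RandProtocol.prob_add_prob {X Y : Type} (μ : RandProtocol X Y) (x : X) (y : Y) :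
    μ.prob x y true + μ.prob x y false = 1 := by
  rw [RandProtocol.prob, RandProtocol.prob, ← (μ.map fun π => π.eval x y).tsum_coe]
  simp [tsum_fintype]

lemma RandProtocol.prob_ne_top {X Y : Type} (μ : RandProtocol X Y) (x : X) (y : Y) (b : Bool) :
    μ.prob x y b ≠ ∞ := PMF.apply_ne_top _ _

lemma RandProtocol.rejectProb_nonneg {X Y : Type} (μ : RandProtocol X Y) (x : X) (y : Y) :
    0 ≤ μ.rejectProb x y := ENNReal.toReal_nonneg

lemma RandProtocol.Computes.two_thirds_le_rejectProb {X Y : Type} {μ : RandProtocol X Y}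
    {f : X → Y → Bool} (h : μ.Computes (ofTotal f)) {x : X} {y : Y} (hf : f x y = false) :
    2 / 3 ≤ μ.rejectProb x y := by
  have h1 := h x y false (by simp [ofTotal, hf])
  have h2 : (2 / 3 : ℝ≥0∞).toReal ≤ (μ.prob x y false).toReal :=
    ENNReal.toReal_mono (PMF.apply_ne_top _ _) h1
  rw [RandProtocol.rejectProb]
  simpa only [ENNReal.toReal_div, ENNReal.toReal_ofNat] using h2

lemma RandProtocol.Computes.rejectProb_le_third {X Y : Type} {μ : RandProtocol X Y}
    {f : X → Y → Bool} (h : μ.Computes (ofTotal f)) {x : X} {y : Y} (hf : f x y = true) :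
    μ.rejectProb x y ≤ 1 / 3 := by
  have h1 := h x y true (by simp [ofTotal, hf])
  have h2 : (2 / 3 : ℝ≥0∞).toReal ≤ (μ.prob x y true).toReal :=
    ENNReal.toReal_mono (PMF.apply_ne_top _ _) h1
  have h3 := congrArg ENNReal.toReal (μ.prob_add_prob x y)
  rw [ENNReal.toReal_add (μ.prob_ne_top x y true) (μ.prob_ne_top x y false)] at h3
  simp only [ENNReal.toReal_div, ENNReal.toReal_ofNat, ENNReal.toReal_one] at h2 h3
  rw [RandProtocol.rejectProb]
  linarith

lemma RandProtocol.exists_mass_mul_rejectProb_le {X Y : Type} [Fintype X] [Fintype Y]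
    [DecidableEq X] [DecidableEq Y] (μ : RandProtocol X Y) (H : X → Y → ℝ) (A : Finset X)
    (B : Finset Y) :
    ∃ π ∈ μ.support, mass (fun x y => H x y * μ.rejectProb x y) A B
      ≤ mass (fun x y => if π.eval x y = false then H x y else 0) A B := by
  -- There are infinitely many protocol trees but only finitely many functions that they compute, so
  -- the average becomes a finite sum.
  set ν : PMF (X → Y → Bool) := μ.map Protocol.eval with hν
  obtain ⟨e, he, hle⟩ := PMF.exists_mem_support_le ν
    fun e => mass (fun x y => if e x y = false then H x y else 0) A B
  obtain ⟨π, hπ, rfl⟩ := (PMF.mem_support_map_iff _ _ _).mp he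
  refine ⟨π, hπ, le_trans (le_of_eq ?_) hle⟩
  have h1 : ∀ x y, μ.rejectProb x y = ∑ e, (ν e).toReal * if e x y = false then 1 else 0 := by
    intro x y
    rw [← PMF.map_apply_toReal ν (fun e => e x y) false, hν, PMF.map_comp]
    rfl
  simp only [mass, h1, mul_sum]
  rw [sum_comm' (t' := A) (s' := fun _ => univ) (by simp)]
  refine sum_congr rfl fun x _ => ?_
  rw [sum_comm]
  refine sum_congr rfl fun y _ => sum_congr rfl fun e _ => ?_
  split_ifs <;> ring

/-- Repeating a protocol `T` times leads to a rectangle on which all runs reject. -/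
lemma RandProtocol.exists_subrectangle {X Y : Type} [Fintype X] [Fintype Y]
    [DecidableEq X] [DecidableEq Y] {μ : RandProtocol X Y} {q : ℕ} (hμ : μ.CostLE q) (T : ℕ)
    (H : X → Y → ℝ) (A : Finset X) (B : Finset Y) :
    ∃ A' B', A' ⊆ A ∧ B' ⊆ B ∧
      mass (fun x y => H x y * μ.rejectProb x y ^ T) A B ≤ (2 ^ q) ^ T * mass H A' B' := by
  induction T generalizing H with
  | zero => exact ⟨A, B, subset_rfl, subset_rfl, by simp⟩
  | succ T ih =>
    -- One factor of the rejection probability is absorbed into the weight; it is removed last,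
    -- inside the rectangle found for the other T runs.
    obtain ⟨A₁, B₁, hA₁, hB₁, h₁⟩ := ih fun x y => H x y * μ.rejectProb x y
    obtain ⟨π, hπ, h₂⟩ := μ.exists_mass_mul_rejectProb_le H A₁ B₁
    obtain ⟨A₂, B₂, hA₂, hB₂, h0, h₃⟩ := π.exists_leaf H A₁ B₁
    refine ⟨A₂, B₂, hA₂.trans hA₁, hB₂.trans hB₁, ?_⟩
    have h4 : (2 : ℝ) ^ π.cost ≤ 2 ^ q := pow_le_pow_right₀ (by norm_num) (hμ π hπ)
    calc _ = mass (fun x y => H x y * μ.rejectProb x y * μ.rejectProb x y ^ T) A B := by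
          congr 1
          funext x y
          ring
      _ ≤ (2 ^ q) ^ T * mass (fun x y => H x y * μ.rejectProb x y) A₁ B₁ := h₁
      _ ≤ (2 ^ q) ^ T * (2 ^ q * mass H A₂ B₂) := by
          gcongr
          exact h₂.trans (h₃.trans (mul_le_mul_of_nonneg_right h4 h0))
      _ = _ := by ring

/-! ### Restricting to a good subrectangle -/

/-- The number of inputs in the slice `k` of the rectangle `A × B` on which `f` is one. -/
noncomputable def errorCount {n m : ℕ} (f : (Fin n → Fin m → Bool) → (Fin n → Fin m → Bool) → Bool)
    (k : ℕ) (A B : Finset (Fin n → Fin m → Bool)) : ℝ :=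
  mass (fun x y => if weight (gadgets x y) = k ∧ f x y = true then (1 : ℝ) else 0) A B

lemma errorCount_nonneg {n m : ℕ} (f : (Fin n → Fin m → Bool) → (Fin n → Fin m → Bool) → Bool)
    (k : ℕ) (A B : Finset (Fin n → Fin m → Bool)) : 0 ≤ errorCount f k A B :=
  sum_nonneg fun x _ => sum_nonneg fun y _ => by dsimp only; split_ifs <;> norm_num

lemma errorCount_le_sliceCount {n m : ℕ}
    (f : (Fin n → Fin m → Bool) → (Fin n → Fin m → Bool) → Bool)
    (k : ℕ) (A B : Finset (Fin n → Fin m → Bool)) : errorCount f k A B ≤ sliceCount k A B :=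
  sum_le_sum fun x _ => sum_le_sum fun y _ => by
    by_cases h1 : weight (gadgets x y) = k <;> by_cases h2 : f x y = true <;> simp [h1, h2]

lemma sliceCount_nonneg {n m : ℕ} (k : ℕ) (A B : Finset (Fin n → Fin m → Bool)) :
    0 ≤ sliceCount k A B :=
  sum_nonneg fun x _ => sum_nonneg fun y _ => by split_ifs <;> norm_num

/-- A rectangle with fixed coordinates `U`, spread outside of `U`, such that `f` is zero on at least
half of its slice `k`. -/
structure IsState {n m : ℕ} (f : (Fin n → Fin m → Bool) → (Fin n → Fin m → Bool) → Bool) (Q : ℝ)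
    (k : ℕ) (U : Finset (Fin n)) (A B : Finset (Fin n → Fin m → Bool)) : Prop where
  fixedA : FixedOn U A
  fixedB : FixedOn U B
  spreadA : Spread Q U (2 * A.card) A
  spreadB : Spread Q U (2 * B.card) B
  pos : 0 < sliceCount k A B
  error : errorCount f k A B ≤ sliceCount k A B / 2

/-- The weights that are positive on the slice `k`, except for the errors there, and negative on the
errors in the slice `k'`. -/
noncomputable def tilt {n m : ℕ} (f : (Fin n → Fin m → Bool) → (Fin n → Fin m → Bool) → Bool)
    (k k' : ℕ) (a b : ℝ) (x y : Fin n → Fin m → Bool) : ℝ :=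
  (if weight (gadgets x y) = k then (1 : ℝ) else 0) * a⁻¹
    - (if weight (gadgets x y) = k ∧ f x y = true then (1 : ℝ) else 0) * (8 * a⁻¹)
    - (if weight (gadgets x y) = k' ∧ f x y = true then (1 : ℝ) else 0) * (8 * b⁻¹)

lemma mass_tilt {n m : ℕ} (f : (Fin n → Fin m → Bool) → (Fin n → Fin m → Bool) → Bool)
    (k k' : ℕ) (a b : ℝ) (A B : Finset (Fin n → Fin m → Bool)) :
    mass (tilt f k k' a b) A B = sliceCount k A B * a⁻¹ - errorCount f k A B * (8 * a⁻¹)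
      - errorCount f k' A B * (8 * b⁻¹) := by
  simp only [mass, tilt, sliceCount, errorCount, sum_sub_distrib, ← sum_mul]

/-- Five rejections have probability at least 32/243 where f = 0 and at most 1/243 where f = 1. An
error in slice k has weight -7 / a, hence the coefficient 39 = 32 + 7. -/
lemma le_tilt_mul_rejectProb_pow {n m : ℕ}
    {f : (Fin n → Fin m → Bool) → (Fin n → Fin m → Bool) → Bool} {k k' : ℕ} {a b : ℝ}
    (ha : 0 < a) (hb : 0 < b) (hk : k ≠ k')
    {μ : RandProtocol (Fin n → Fin m → Bool) (Fin n → Fin m → Bool)}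
    (hμ : μ.Computes (ofTotal f)) (x y : Fin n → Fin m → Bool) :
    (if weight (gadgets x y) = k then (1 : ℝ) else 0) * (32 / 243 * a⁻¹)
    - (if weight (gadgets x y) = k ∧ f x y = true then (1 : ℝ) else 0) * (39 / 243 * a⁻¹)
    - (if weight (gadgets x y) = k' ∧ f x y = true then (1 : ℝ) else 0) * (8 / 243 * b⁻¹)
      ≤ tilt f k k' a b x y * μ.rejectProb x y ^ 5 := by
  have ha' : 0 < a⁻¹ := inv_pos.mpr ha
  have hb' : 0 < b⁻¹ := inv_pos.mpr hb
  have hp0 := μ.rejectProb_nonneg x y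
  have hp1 : f x y = true → μ.rejectProb x y ^ 5 ≤ 1 / 243 := fun hf => by
    have := pow_le_pow_left₀ hp0 (hμ.rejectProb_le_third hf) 5
    norm_num at this ⊢
    exact this
  have hp2 : f x y = false → 32 / 243 ≤ μ.rejectProb x y ^ 5 := fun hf => by
    have := pow_le_pow_left₀ (by norm_num) (hμ.two_thirds_le_rejectProb hf) 5
    norm_num at this ⊢
    exact this
  rw [tilt]
  generalize μ.rejectProb x y ^ 5 = p at hp1 hp2
  by_cases h1 : weight (gadgets x y) = k
  · have h2 : weight (gadgets x y) ≠ k' := fun h => hk (h1.symm.trans h)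
    by_cases hf : f x y = true
    · have := hp1 hf
      simp [h1, hk, hf]
      nlinarith
    · rw [Bool.not_eq_true] at hf
      have := hp2 hf
      simp [h1, hf]
      nlinarith
  · by_cases hf : f x y = true
    · have := hp1 hf
      by_cases h2 : weight (gadgets x y) = k'
      · simp [h2, Ne.symm hk, hf]
        nlinarith
      · simp [h1, h2]
    · simp [h1, hf]

lemma mass_mono {X Y : Type} {H H' : X → Y → ℝ} {A : Finset X} {B : Finset Y}
    (h : ∀ x y, H x y ≤ H' x y) : mass H A B ≤ mass H' A B :=
  sum_le_sum fun x _ => sum_le_sum fun y _ => h x y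

/-- Both error bounds are read off from the positivity of the tilted weight after restoration. The
last inequality, which also uses that the tilted weight is at most the relative size of slice k,
records the price paid in size. -/
lemma IsState.exists_restriction {n m q k k' : ℕ}
    {f : (Fin n → Fin m → Bool) → (Fin n → Fin m → Bool) → Bool} {Q w : ℝ} {I : Finset (Fin n)}
    {X Y : Finset (Fin n → Fin m → Bool)} (h : IsState f Q k I X Y) (hQ : 0 < Q) (hw : 0 < w)
    (hwn : 16 * n * (2 ^ m * Q) ≤ w)
    {μ : RandProtocol (Fin n → Fin m → Bool) (Fin n → Fin m → Bool)}
    (hμ : μ.Computes (ofTotal f)) (hq : μ.CostLE q) (hk : k ≠ k') (hpos : 0 < sliceCount k' X Y) :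
    ∃ A B U, A ⊆ X ∧ B ⊆ Y ∧ I ⊆ U ∧ FixedOn U A ∧ FixedOn U B ∧
      Spread Q U (2 * A.card) A ∧ Spread Q U (2 * B.card) B ∧
      0 < sliceCount k A B ∧ errorCount f k A B ≤ sliceCount k A B / 8 ∧
      8 * errorCount f k' A B * sliceCount k X Y ≤ sliceCount k A B * sliceCount k' X Y ∧
      (w ^ I.card) ^ 4 * ((A.card * Q ^ U.card) * (B.card * Q ^ U.card))
        ≤ ((2 ^ q) ^ 5 * 64) ^ 4 * (sliceCount k A B / sliceCount k X Y * w ^ U.card) ^ 4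
          * ((2 * X.card * Q ^ I.card) * (2 * Y.card * Q ^ I.card)) := by
  set a := sliceCount k X Y with ha
  set b := sliceCount k' X Y with hb
  have ha0 : 0 < a := h.pos
  set H := tilt f k k' a b with hH
  -- At most half of slice k and at worst all of slice k' are errors: 32/243 - 39/486 - 8/243 =
  -- 1/54.
  have h1 : 1 / 64 ≤ mass (fun x y => H x y * μ.rejectProb x y ^ 5) X Y := by
    refine le_trans ?_ (mass_mono (le_tilt_mul_rejectProb_pow ha0 hpos hk hμ))
    simp only [mass, sum_sub_distrib, ← sum_mul]
    have e1 : (∑ x ∈ X, ∑ y ∈ Y, if weight (gadgets x y) = k then (1 : ℝ) else 0) = a := rfl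
    have e2 : (∑ x ∈ X, ∑ y ∈ Y, if weight (gadgets x y) = k ∧ f x y = true then (1 : ℝ) else 0)
        ≤ a / 2 := h.error
    have e3 : (∑ x ∈ X, ∑ y ∈ Y, if weight (gadgets x y) = k' ∧ f x y = true then (1 : ℝ) else 0)
        ≤ b := errorCount_le_sliceCount f k' X Y
    rw [e1]
    have e2' := mul_le_mul_of_nonneg_right e2 (by positivity : 0 ≤ 39 / 243 * a⁻¹)
    have e3' := mul_le_mul_of_nonneg_right e3 (by positivity : 0 ≤ 8 / 243 * b⁻¹)
    have e4 : a / 2 * (39 / 243 * a⁻¹) = 39 / 486 := by field_simp; norm_num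
    have e5 : b * (8 / 243 * b⁻¹) = 8 / 243 := by field_simp
    have e6 : a * (32 / 243 * a⁻¹) = 32 / 243 := by field_simp
    rw [e6]
    linarith
  obtain ⟨A₀, B₀, hA₀, hB₀, h2⟩ := RandProtocol.exists_subrectangle hq 5 H X Y
  have hm0 : 1 ≤ (2 ^ q) ^ 5 * 64 * mass H A₀ B₀ := by linarith
  have hm0' : 0 < mass H A₀ B₀ := by
    by_contra! hneg
    have : (2 ^ q) ^ 5 * 64 * mass H A₀ B₀ ≤ 0 := mul_nonpos_of_nonneg_of_nonpos (by positivity) hneg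
    linarith
  obtain ⟨A, B, U, hA, hB, hU, hfA, hfB, hm, hsA, hsB, hsize⟩ := exists_spread_subrectangle hQ hw
    (by simpa using hwn) hm0' (h.fixedA.mono hA₀) (h.fixedB.mono hB₀)
  have hmass := mass_tilt f k k' a b A B
  rw [← hH] at hmass
  have hea := errorCount_nonneg f k A B
  have heb := errorCount_nonneg f k' A B
  have ha' : 0 < a⁻¹ := inv_pos.mpr ha0
  have hb' : 0 < b⁻¹ := inv_pos.mpr hpos
  have hle : mass H A B ≤ sliceCount k A B / a := by
    rw [hmass, div_eq_mul_inv]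
    have := mul_nonneg hea ha'.le
    have := mul_nonneg heb hb'.le
    linarith
  refine ⟨A, B, U, hA.trans hA₀, hB.trans hB₀, hU, hfA, hfB, hsA, hsB, ?_, ?_, ?_, ?_⟩
  · have := hm.trans_le hle
    exact (div_pos_iff_of_pos_right ha0).mp this
  · rw [hmass] at hm
    have h3 : 0 < (sliceCount k A B - 8 * errorCount f k A B) * a⁻¹ := by
      have := mul_nonneg heb hb'.le
      linarith
    have := (mul_pos_iff_of_pos_right ha').mp h3
    linarith
  · rw [hmass] at hm
    have h3 : errorCount f k' A B * (8 * b⁻¹) ≤ sliceCount k A B * a⁻¹ := by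
      have := mul_nonneg hea ha'.le
      linarith
    have h4 := mul_le_mul_of_nonneg_right h3 (mul_pos ha0 hpos).le
    field_simp at h4
    linarith
  · have c1 : concentration Q I A₀ ≤ 2 * X.card * Q ^ I.card :=
      (concentration_mono hQ I hA₀).trans (h.spreadA.concentration_le hQ (by positivity))
    have c2 : concentration Q I B₀ ≤ 2 * Y.card * Q ^ I.card :=
      (concentration_mono hQ I hB₀).trans (h.spreadB.concentration_le hQ (by positivity))
    have c3 := concentration_nonneg hQ I B₀
    have c4 := mul_nonneg (concentration_nonneg hQ I A₀) c3
    calc _ ≤ ((2 ^ q) ^ 5 * 64 * mass H A₀ B₀) ^ 4 *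
          ((w ^ I.card) ^ 4 * ((A.card * Q ^ U.card) * (B.card * Q ^ U.card))) :=
          le_mul_of_one_le_left (by positivity) (one_le_pow₀ hm0)
      _ = ((2 ^ q) ^ 5 * 64) ^ 4 * ((mass H A₀ B₀ * w ^ I.card) ^ 4 *
          ((A.card * Q ^ U.card) * (B.card * Q ^ U.card))) := by ring
      _ ≤ ((2 ^ q) ^ 5 * 64) ^ 4 * ((mass H A B * w ^ U.card) ^ 4 *
          (concentration Q I A₀ * concentration Q I B₀)) := by gcongr
      _ ≤ ((2 ^ q) ^ 5 * 64) ^ 4 * ((sliceCount k A B / a * w ^ U.card) ^ 4 *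
          ((2 * X.card * Q ^ I.card) * (2 * Y.card * Q ^ I.card))) := by gcongr
      _ = _ := by ring

/-! ### Numerical estimates -/

lemma choose_le_choose_add_add (N κ r w : ℕ) (hw : w ≤ r) :
    N.choose κ ≤ (N + r).choose (κ + w) := by
  have h1 : ∀ w, N.choose κ ≤ (N + w).choose (κ + w) := by
    intro w
    induction w with
    | zero => simp
    | succ w ih =>
      rw [← add_assoc, ← add_assoc, Nat.choose_succ_succ]
      exact ih.trans (Nat.le_add_right _ _)
  exact (h1 w).trans (Nat.choose_le_choose _ (by omega))

/-- Fixing `r` coordinates, `w` of them to one, hardly affects how the sizes of nearby slices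
compare. -/
lemma choose_mul_choose_le {N r κ w j M : ℕ} (hw : w ≤ r) (hM : 0 < M)
    (hN : κ + w + j + M ≤ N + r) (hjr : 2 * (j * r) ≤ M) (hrM : r ≤ M) :
    ((N.choose κ : ℝ) * (N + r).choose (κ + w + j))
      ≤ 2 * (N.choose (κ + j) * (N + r).choose (κ + w)) := by
  have hM' : (0 : ℝ) < M := by exact_mod_cast hM
  have hrM' : (r : ℝ) ≤ M := by exact_mod_cast hrM
  set ρ : ℝ := 1 - r / M with hρ
  have hρ0 : 0 ≤ ρ := by
    rw [hρ, sub_nonneg, div_le_one hM']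
    exact hrM'
  -- Compare ratios of consecutive binomial coefficients. With D = N + r - κ - w - i ≥ M, the
  -- numerator N - κ - i is at least D - r ≥ D ρ, so each step loses at most ρ; Bernoulli's
  -- inequality gives ρ^j ≥ 1/2.
  have key : ∀ i ≤ j, (N.choose κ : ℝ) * (N + r).choose (κ + w + i) * ρ ^ i
      ≤ N.choose (κ + i) * (N + r).choose (κ + w) := by
    intro i hi
    induction i with
    | zero => simp
    | succ i ih =>
      have ih := ih (by omega)
      have h1 : ((N + r).choose (κ + w + (i + 1)) : ℝ) * (κ + w + i + 1)
          = (N + r).choose (κ + w + i) * (N + r - κ - w - i) := by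
        have h0 := Nat.choose_succ_right_eq (N + r) (κ + w + i)
        have h3 : κ + w + i ≤ N + r := by omega
        have := congrArg (Nat.cast (R := ℝ)) h0
        push_cast [Nat.cast_sub h3] at this
        rw [← add_assoc]
        linarith
      have h2 : (N.choose (κ + (i + 1)) : ℝ) * (κ + i + 1)
          = N.choose (κ + i) * (N - κ - i) := by
        have h0 := Nat.choose_succ_right_eq N (κ + i)
        have h3 : κ + i ≤ N := by omega
        have := congrArg (Nat.cast (R := ℝ)) h0
        push_cast [Nat.cast_sub h3] at this
        rw [← add_assoc]
        linarith
      have hD : (M : ℝ) ≤ N + r - κ - w - i := by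
        have : M + κ + w + i ≤ N + r := by omega
        have : ((M + κ + w + i : ℕ) : ℝ) ≤ (N + r : ℕ) := by exact_mod_cast this
        push_cast at this
        linarith
      have hw' : (w : ℝ) ≤ r := by exact_mod_cast hw
      set D : ℝ := N + r - κ - w - i with hDdef
      have hE : D * ρ ≤ N - κ - i := by
        have h3 : (r : ℝ) ≤ D * (r / M) := by
          rw [← mul_div_assoc, le_div_iff₀ hM', mul_comm]
          gcongr
        have h4 : (0 : ℝ) ≤ w := Nat.cast_nonneg w
        rw [hρ, mul_sub, mul_one]
        linarith
      have hD0 : 0 ≤ D * ρ := mul_nonneg (hM'.le.trans hD) hρ0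
      have s1 : (0 : ℝ) < κ + i + 1 := by positivity
      have s2 : (0 : ℝ) < κ + w + i + 1 := by positivity
      have h5 : ((N + r).choose (κ + w + (i + 1)) : ℝ)
          = (N + r).choose (κ + w + i) * (D / (κ + w + i + 1)) := by
        rw [← mul_div_assoc, eq_div_iff s2.ne', h1]
      have h6 : (N.choose (κ + (i + 1)) : ℝ)
          = N.choose (κ + i) * ((N - κ - i) / (κ + i + 1)) := by
        rw [← mul_div_assoc, eq_div_iff s1.ne', h2]
      rw [h5, h6]
      calc _ = (N.choose κ * (N + r).choose (κ + w + i) * ρ ^ i) * (D * ρ / (κ + w + i + 1)) := by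
            rw [pow_succ]; ring
        _ ≤ (N.choose (κ + i) * (N + r).choose (κ + w)) * ((N - κ - i) / (κ + i + 1)) := by
            have : (0 : ℝ) ≤ w := Nat.cast_nonneg w
            gcongr <;> linarith
        _ = _ := by ring
  have h1 := key j le_rfl
  have h2 : 1 / 2 ≤ ρ ^ j := by
    have h3 := one_add_mul_le_pow (a := -(r / M : ℝ)) (by
      have : (r : ℝ) / M ≤ 1 := by rw [div_le_one hM']; exact hrM'
      linarith) j
    have h4 : (j : ℝ) * (r / M) ≤ 1 / 2 := by
      rw [← mul_div_assoc, div_le_iff₀ hM']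
      have : ((2 * (j * r) : ℕ) : ℝ) ≤ M := by exact_mod_cast hjr
      push_cast at this
      linarith
    have h5 : 1 + -(r / M : ℝ) = ρ := by rw [hρ]; ring
    rw [h5] at h3
    linarith
  have h3 : 0 ≤ (N.choose κ : ℝ) * (N + r).choose (κ + w + j) := by positivity
  nlinarith

/-! ### Advancing to higher slices -/

/-- The logarithm of the inverse density of the rectangle `A × B` in the set of all inputs with some
prescribed coordinates in `U`. -/
noncomputable def deficiency {n m : ℕ} (U : Finset (Fin n)) (A B : Finset (Fin n → Fin m → Bool)) :
    ℝ := 2 * m * (n - U.card) - Real.logb 2 (A.card * B.card)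

/-- The number of gadgets in `U` that evaluate to one. -/
def onesIn {n m : ℕ} (U : Finset (Fin n)) (x y : Fin n → Fin m → Bool) : ℕ :=
  (U.filter fun i => gadgets x y i = true).card

/-- The conditions that relate the gadget size to the spread rate. -/
structure IsRate (n m : ℕ) (Q : ℝ) : Prop where
  pos : 0 < Q
  pow_four : Q ^ 4 = 2 ^ (3 * m)
  mul_le : n * (Q / 2 ^ m) ≤ 1 / 40
  pow_le : (32 * n : ℝ) ^ 16 ≤ 2 ^ m

lemma FixedOn.gadgets_eq {n m : ℕ} {U : Finset (Fin n)} {A B : Finset (Fin n → Fin m → Bool)}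
    (hA : FixedOn U A) (hB : FixedOn U B) {x y x' y' : Fin n → Fin m → Bool} (hx : x ∈ A)
    (hy : y ∈ B) (hx' : x' ∈ A) (hy' : y' ∈ B) : ∀ i ∈ U, gadgets x y i = gadgets x' y' i := by
  intro i hi
  rw [gadgets, gadgets, hA x hx x' hx' i hi, hB y hy y' hy' i hi]

/-- With η = Q / 2^m one has η² Q² = Q^4 / 2^(2m) = 2^m exactly, and δ = 1/40 gives relative error
4δ = 1/10. -/
lemma IsRate.sliceCount_bounds {n m : ℕ} {Q : ℝ} (hR : IsRate n m Q)
    {A B : Finset (Fin n → Fin m → Bool)} {U : Finset (Fin n)} (hfA : FixedOn U A)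
    (hfB : FixedOn U B) (hA : Spread Q U (2 * A.card) A) (hB : Spread Q U (2 * B.card) B)
    {x y : Fin n → Fin m → Bool} (hx : x ∈ A) (hy : y ∈ B) (κ : ℕ) :
    9 / 10 * ((Uᶜ).card.choose κ * ((2 : ℝ) ^ (Uᶜ).card)⁻¹ * (A.card * B.card))
        ≤ sliceCount (κ + onesIn U x y) A B ∧
      sliceCount (κ + onesIn U x y) A B
        ≤ 11 / 10 * ((Uᶜ).card.choose κ * ((2 : ℝ) ^ (Uᶜ).card)⁻¹ * (A.card * B.card)) := by
  have hQ := hR.pos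
  have h := abs_le.mp (abs_sliceCount_sub_le (η := Q / 2 ^ m) (δ := 1 / 40) hR.pos (by positivity)
    (by
      have : (Q / 2 ^ m) ^ 2 * Q ^ 2 = Q ^ 4 / (2 ^ m) ^ 2 := by ring
      rw [this, hR.pow_four, show (2 : ℝ) ^ (3 * m) = (2 ^ m) ^ 3 by rw [← pow_mul, mul_comm]]
      field_simp
      exact le_rfl)
    hR.mul_le (by norm_num) hA hB (z := gadgets x y)
    (fun x' hx' y' hy' => hfA.gadgets_eq hfB hx' hy' hx hy) κ)
  rw [onesIn]
  constructor <;> linarith [h.1, h.2]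

lemma onesIn_le_card {n m : ℕ} (U : Finset (Fin n)) (x y : Fin n → Fin m → Bool) :
    onesIn U x y ≤ U.card := card_filter_le _ _

lemma onesIn_le_weight {n m : ℕ} (U : Finset (Fin n)) (x y : Fin n → Fin m → Bool) :
    onesIn U x y ≤ weight (gadgets x y) :=
  card_le_card (filter_subset_filter _ (subset_univ U))

lemma onesIn_mono {n m : ℕ} {I U : Finset (Fin n)} (hU : I ⊆ U) (x y : Fin n → Fin m → Bool) :
    onesIn I x y ≤ onesIn U x y ∧ onesIn U x y + I.card ≤ onesIn I x y + U.card := by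
  refine ⟨card_le_card (filter_subset_filter _ hU), ?_⟩
  have h1 : onesIn U x y = onesIn I x y + onesIn (U \ I) x y := by
    rw [onesIn, onesIn, onesIn, ← card_union_of_disjoint, ← filter_union, union_sdiff_of_subset hU]
    exact disjoint_filter_filter disjoint_sdiff
  have h2 := onesIn_le_card (U \ I) x y
  have h3 := card_sdiff_add_card_eq_card hU
  omega

lemma exists_mem_of_sliceCount_pos {n m k : ℕ} {A B : Finset (Fin n → Fin m → Bool)}
    (h : 0 < sliceCount k A B) : ∃ x ∈ A, ∃ y ∈ B, weight (gadgets x y) = k := by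
  by_contra! h0
  have : sliceCount k A B = 0 := sum_eq_zero fun x hx => sum_eq_zero fun y hy => if_neg (h0 x hx y hy)
  linarith

/-- Here x and a are the sizes of the old and new rectangles and g is the relative size of slice k.
Inserting the bound on g leaves x³ against a³; a further fourth power makes Q appear only through
Q^4 = 2^(3m). Each new block then costs (32n)^16 · 2^(16m) · Q^8 ≤ 2^(23m). -/
lemma IsRate.pow_twelve_le {n m q r i : ℕ} {Q a x g : ℝ} (hR : IsRate n m Q) (ha : 0 < a)
    (hx : 0 < x) (hg : 0 ≤ g) (hgr : g ≤ 2 ^ (r + 1) * (a / x))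
    (h : ((16 * n * (2 ^ m * Q)) ^ i) ^ 4 * (a * (Q ^ (i + r)) ^ 2)
      ≤ ((2 ^ q) ^ 5 * 64) ^ 4 * (g * (16 * n * (2 ^ m * Q)) ^ (i + r)) ^ 4 * (4 * x * (Q ^ i) ^ 2))
    (hn : 0 < n) :
    x ^ 12 ≤ 2 ^ (80 * q + 120) * 2 ^ (23 * m * r) * a ^ 12 := by
  have hQ := hR.pos
  set w : ℝ := 16 * n * (2 ^ m * Q) with hw
  have hn' : (0 : ℝ) < n := by exact_mod_cast hn
  have hw0 : 0 < w := by positivity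
  have h1 : (w ^ i) ^ 4 * (a * (Q ^ (i + r)) ^ 2)
      ≤ ((2 ^ q) ^ 5 * 64) ^ 4 * (2 ^ (r + 1) * (a / x) * w ^ (i + r)) ^ 4
        * (4 * x * (Q ^ i) ^ 2) := h.trans (by gcongr)
  have h2 : x ^ 3 * (Q ^ 2) ^ r ≤ 2 ^ (20 * q + 30) * (16 * w ^ 4) ^ r * a ^ 3 := by
    have e1 : (w ^ i) ^ 4 * (a * (Q ^ (i + r)) ^ 2)
        = (x ^ 3 * (Q ^ 2) ^ r) * ((w ^ i) ^ 4 * a * (Q ^ i) ^ 2 / x ^ 3) := by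
      field_simp
      ring
    have e2 : ((2 ^ q) ^ 5 * 64) ^ 4 * (2 ^ (r + 1) * (a / x) * w ^ (i + r)) ^ 4
          * (4 * x * (Q ^ i) ^ 2)
        = (2 ^ (20 * q + 30) * (16 * w ^ 4) ^ r * a ^ 3)
          * ((w ^ i) ^ 4 * a * (Q ^ i) ^ 2 / x ^ 3) := by
      have e3 : ((2 : ℝ) ^ q) ^ 20 = 2 ^ (20 * q) := by rw [← pow_mul, mul_comm]
      have e4 : ((2 : ℝ) ^ r) ^ 4 = 16 ^ r := by
        rw [← pow_mul, mul_comm, pow_mul]; norm_num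
      rw [pow_add (2 : ℝ) (20 * q), ← e3, mul_pow 16, ← e4]
      field_simp
      ring_nf
    rw [e1, e2] at h1
    exact le_of_mul_le_mul_right h1 (by positivity)
  have h3 : (16 * w ^ 4) = (32 * n) ^ 4 * (2 ^ m) ^ 4 * Q ^ 4 := by rw [hw]; ring_nf
  have h4 : x ^ 3 ≤ 2 ^ (20 * q + 30) * ((32 * n) ^ 4 * (2 ^ m) ^ 4 * Q ^ 2) ^ r * a ^ 3 := by
    have e1 : 2 ^ (20 * q + 30) * ((32 * n) ^ 4 * (2 ^ m) ^ 4 * Q ^ 4) ^ r * a ^ 3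
        = (2 ^ (20 * q + 30) * ((32 * n) ^ 4 * (2 ^ m) ^ 4 * Q ^ 2) ^ r * a ^ 3) * (Q ^ 2) ^ r := by
      rw [show (32 * n : ℝ) ^ 4 * (2 ^ m) ^ 4 * Q ^ 4
        = ((32 * n) ^ 4 * (2 ^ m) ^ 4 * Q ^ 2) * Q ^ 2 by ring, mul_pow _ (Q ^ 2)]
      ring
    rw [h3, e1] at h2
    exact le_of_mul_le_mul_right h2 (by positivity)
  have h5 : ((32 * n : ℝ) ^ 4 * (2 ^ m) ^ 4 * Q ^ 2) ^ 4 ≤ 2 ^ (23 * m) := by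
    calc _ = (32 * n : ℝ) ^ 16 * (2 ^ m) ^ 16 * (Q ^ 4) ^ 2 := by ring
      _ ≤ 2 ^ m * (2 ^ m) ^ 16 * (2 ^ (3 * m)) ^ 2 := by
          rw [hR.pow_four]
          have := hR.pow_le
          gcongr
      _ = _ := by
          simp only [← pow_mul, ← pow_add]
          congr 1
          ring
  calc x ^ 12 = (x ^ 3) ^ 4 := by ring
    _ ≤ (2 ^ (20 * q + 30) * ((32 * n) ^ 4 * (2 ^ m) ^ 4 * Q ^ 2) ^ r * a ^ 3) ^ 4 := by gcongr
    _ = 2 ^ (80 * q + 120) * (((32 * n) ^ 4 * (2 ^ m) ^ 4 * Q ^ 2) ^ 4) ^ r * a ^ 12 := by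
        rw [mul_pow, mul_pow, ← pow_mul, ← pow_mul _ r 4, mul_comm r 4, pow_mul _ 4 r,
          ← pow_mul a, show (20 * q + 30) * 4 = 80 * q + 120 by ring]
    _ ≤ 2 ^ (80 * q + 120) * (2 ^ (23 * m)) ^ r * a ^ 12 := by gcongr
    _ = _ := by rw [← pow_mul]

/-- Fixing a block lowers the ambient term of 12 times the deficiency by 24m, while the loss in size
accounts for only 23m; the difference m per block is the gain. -/
lemma deficiency_le {n m q r : ℕ} {I U : Finset (Fin n)} {A B X Y : Finset (Fin n → Fin m → Bool)}
    (hr : U.card = I.card + r) (ha : (0 : ℝ) < A.card * B.card) (hx : (0 : ℝ) < X.card * Y.card)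
    (h : (X.card * Y.card : ℝ) ^ 12
      ≤ 2 ^ (80 * q + 120) * 2 ^ (23 * m * r) * (A.card * B.card : ℝ) ^ 12) :
    12 * deficiency U A B + m * (U.card - I.card : ℝ)
      ≤ 12 * deficiency I X Y + (80 * q + 120) := by
  rw [deficiency, deficiency, hr]
  generalize (A.card * B.card : ℝ) = a at *
  generalize (X.card * Y.card : ℝ) = x at *
  have hlog := Real.logb_le_logb_of_le (b := 2) (by norm_num) (by positivity) h
  have e1 : (2 : ℝ) ^ (80 * q + 120) ≠ 0 := by positivity
  have e2 : (2 : ℝ) ^ (23 * m * r) ≠ 0 := by positivity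
  have e3 : a ^ 12 ≠ 0 := by positivity
  rw [Real.logb_mul (mul_ne_zero e1 e2) e3, Real.logb_mul e1 e2,
    Real.logb_pow, Real.logb_pow, Real.logb_pow, Real.logb_pow,
    Real.logb_self_eq_one (by norm_num)] at hlog
  push_cast at hlog ⊢
  linarith

/-- Here s, s' are slices k, k + j of the new rectangle, t, t' those of the old one, and a, a', b,
b' their binomial estimates. The initial factor 8 absorbs the factor 2 from the binomials and the
four approximation errors. -/
lemma error_le_half {a a' b b' e s s' t t' : ℝ} (hb : 0 < b) (ha : 0 ≤ a)
    (ht : 0 ≤ t') (he : 0 ≤ e) (h : a * b' ≤ 2 * (a' * b)) (hle : 8 * e * t ≤ s * t')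
    (h1 : s ≤ 11 / 10 * a) (h2 : 9 / 10 * a' ≤ s') (h3 : 9 / 10 * b ≤ t)
    (h4 : t' ≤ 11 / 10 * b') : e ≤ s' / 2 := by
  have e1 : 8 * e * (9 / 10 * b) ≤ 11 / 10 * a * (11 / 10 * b') := by
    calc _ ≤ 8 * e * t := by gcongr
      _ ≤ s * t' := hle
      _ ≤ _ := mul_le_mul h1 h4 ht (by positivity)
  have e2 : 36 / 5 * e ≤ 121 / 50 * a' := by
    refine le_of_mul_le_mul_right ?_ hb
    linarith
  linarith

/-- From a good rectangle one can pass to a smaller one that is also good, for the same slice or, if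
few new coordinates were fixed, for a higher slice. -/
theorem IsState.advance {n m q k j M : ℕ}
    {f : (Fin n → Fin m → Bool) → (Fin n → Fin m → Bool) → Bool} {Q : ℝ} {I : Finset (Fin n)}
    {X Y : Finset (Fin n → Fin m → Bool)} (h : IsState f Q k I X Y) (hR : IsRate n m Q)
    {μ : RandProtocol (Fin n → Fin m → Bool) (Fin n → Fin m → Bool)}
    (hμ : μ.Computes (ofTotal f)) (hq : μ.CostLE q) (hj : 0 < j) (hM : 0 < M)
    (hkn : k + j + M + I.card ≤ n) :
    ∃ A B U, I ⊆ U ∧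
      12 * deficiency U A B + m * (U.card - I.card : ℝ) ≤ 12 * deficiency I X Y + (80 * q + 120) ∧
      IsState f Q k U A B ∧
      (2 * (j * (U.card - I.card)) ≤ M → IsState f Q (k + j) U A B) := by
  have hQ := hR.pos
  have hn : 0 < n := by omega
  have hn' : (0 : ℝ) < n := by exact_mod_cast hn
  have hNI : (Iᶜ).card + I.card = n := by
    rw [card_compl_add_card, Fintype.card_fin]
  obtain ⟨x₁, hx₁, y₁, hy₁, hk₁⟩ := exists_mem_of_sliceCount_pos h.pos
  have hX : (0 : ℝ) < X.card := by exact_mod_cast card_pos.mpr ⟨x₁, hx₁⟩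
  have hY : (0 : ℝ) < Y.card := by exact_mod_cast card_pos.mpr ⟨y₁, hy₁⟩
  have hpos : 0 < sliceCount (k + j) X Y := by
    have h1 := onesIn_le_weight I x₁ y₁
    have h2 := (hR.sliceCount_bounds h.fixedA h.fixedB h.spreadA h.spreadB hx₁ hy₁
      (k + j - onesIn I x₁ y₁)).1
    rw [Nat.sub_add_cancel (by omega)] at h2
    refine lt_of_lt_of_le ?_ h2
    have h3 : 0 < (Iᶜ).card.choose (k + j - onesIn I x₁ y₁) := Nat.choose_pos (by omega)
    positivity
  obtain ⟨A, B, U, hA, hB, hU, hfA, hfB, hsA, hsB, hpA, herr, herr', hsize⟩ :=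
    h.exists_restriction (w := 16 * n * (2 ^ m * Q)) hQ (by positivity) le_rfl hμ hq
      (k' := k + j) (by omega) hpos
  obtain ⟨x, hx, y, hy, hk⟩ := exists_mem_of_sliceCount_pos hpA
  have hxX := hA hx
  have hyY := hB hy
  have hAc : (0 : ℝ) < A.card := by exact_mod_cast card_pos.mpr ⟨x, hx⟩
  have hBc : (0 : ℝ) < B.card := by exact_mod_cast card_pos.mpr ⟨y, hy⟩
  have hNU : (Uᶜ).card + U.card = n := by
    rw [card_compl_add_card, Fintype.card_fin]
  -- Parameters of the slice: r new blocks are fixed, w of their gadgets are one, and on slice k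
  -- exactly κ gadgets outside U are one.
  have hIU := card_le_card hU
  obtain ⟨r, hr⟩ := Nat.exists_eq_add_of_le hIU
  have hNr : (Iᶜ).card = (Uᶜ).card + r := by omega
  obtain ⟨hw1, hw2⟩ := onesIn_mono hU x y
  obtain ⟨w, hw⟩ := Nat.exists_eq_add_of_le hw1
  have hwr : w ≤ r := by omega
  obtain ⟨κ, hκ⟩ := Nat.exists_eq_add_of_le' (onesIn_le_weight U x y)
  rw [hk] at hκ
  have bA := hR.sliceCount_bounds hfA hfB hsA hsB hx hy
  have bX := hR.sliceCount_bounds h.fixedA h.fixedB h.spreadA h.spreadB hxX hyY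
  set NU := (Uᶜ).card with hNUdef
  set V : ℝ := ((2 : ℝ) ^ NU)⁻¹ * (A.card * B.card) with hV
  set V' : ℝ := ((2 : ℝ) ^ (NU + r))⁻¹ * (X.card * Y.card) with hV'
  have hV0 : 0 < V := by positivity
  have hV'0 : 0 < V' := by positivity
  rw [hNr] at bX
  have b1 := bA κ
  have b2 := bA (κ + j)
  have b3 := bX (κ + w)
  have b4 := bX (κ + w + j)
  rw [← hκ] at b1
  rw [show κ + j + onesIn U x y = k + j by omega] at b2
  rw [show κ + w + onesIn I x y = k by omega] at b3
  rw [show κ + w + j + onesIn I x y = k + j by omega] at b4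
  rw [mul_assoc ((NU.choose κ : ℕ) : ℝ), ← hV] at b1
  rw [mul_assoc ((NU.choose (κ + j) : ℕ) : ℝ), ← hV] at b2
  rw [mul_assoc (((NU + r).choose (κ + w) : ℕ) : ℝ), ← hV'] at b3
  rw [mul_assoc (((NU + r).choose (κ + w + j) : ℕ) : ℝ), ← hV'] at b4
  have hκNU : κ ≤ NU := by
    by_contra! hlt
    have := b1.2
    rw [Nat.choose_eq_zero_of_lt hlt] at this
    simp at this
    linarith
  refine ⟨A, B, U, hU, ?_, ⟨hfA, hfB, hsA, hsB, hpA, by linarith⟩, fun hjr => ?_⟩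
  · set g := sliceCount k A B / sliceCount k X Y with hg
    have hg0 : 0 ≤ g := div_nonneg hpA.le h.pos.le
    have hgr : g ≤ 2 ^ (r + 1) * ((A.card * B.card : ℝ) / (X.card * Y.card)) := by
      rw [hg, div_le_iff₀ h.pos]
      have hc : (NU.choose κ : ℝ) ≤ (NU + r).choose (κ + w) := by
        exact_mod_cast choose_le_choose_add_add NU κ r w hwr
      have hVV : 2 ^ r * ((A.card * B.card : ℝ) / (X.card * Y.card)) * V' = V := by
        rw [hV, hV', pow_add]
        field_simp
      calc sliceCount k A B ≤ 11 / 10 * (NU.choose κ * V) := b1.2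
        _ ≤ 11 / 10 * ((NU + r).choose (κ + w) * V) := by gcongr
        _ ≤ 2 * (9 / 10 * ((NU + r).choose (κ + w) * V)) := by
            have : 0 ≤ ((NU + r).choose (κ + w) : ℝ) * V := by positivity
            linarith
        _ = 2 ^ (r + 1) * ((A.card * B.card : ℝ) / (X.card * Y.card))
            * (9 / 10 * ((NU + r).choose (κ + w) * V')) := by
            rw [← hVV, pow_succ]; ring
        _ ≤ _ := by gcongr; exact b3.1
    have h12 := hR.pow_twelve_le (a := A.card * B.card) (x := X.card * Y.card) (i := I.card)
      (r := r) (mul_pos hAc hBc) (mul_pos hX hY) hg0 hgr (by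
        rw [hr] at hsize
        refine (Eq.le ?_).trans (hsize.trans (Eq.le ?_))
        · ring
        · ring) hn
    exact deficiency_le hr (mul_pos hAc hBc) (mul_pos hX hY) h12
  · have hjr' : 2 * (j * r) ≤ M := by rwa [hr, Nat.add_sub_cancel_left] at hjr
    have hrM : r ≤ M := by nlinarith
    have hc := choose_mul_choose_le (N := NU) (κ := κ) hwr hM (by omega) hjr' hrM
    have hκj : κ + j ≤ NU := by omega
    have c1 : 0 < (NU.choose (κ + j) : ℝ) := by exact_mod_cast Nat.choose_pos hκj
    have c2 : 0 < ((NU + r).choose (κ + w) : ℝ) := by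
      exact_mod_cast Nat.choose_pos (by omega)
    refine ⟨hfA, hfB, hsA, hsB,
      lt_of_lt_of_le (mul_pos (by norm_num) (mul_pos c1 hV0)) b2.1, ?_⟩
    have he := errorCount_nonneg f (k + j) A B
    refine error_le_half (mul_pos c2 hV'0) (mul_nonneg (Nat.cast_nonneg (NU.choose κ)) hV0.le)
      hpos.le he ?_ herr' b1.2 b2.1 b3.1 b4.2
    refine (Eq.le ?_).trans ((mul_le_mul_of_nonneg_right hc (mul_pos hV0 hV'0).le).trans
      (Eq.le ?_))
    · ring
    · ring

/-! ### The lower bound -/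

lemma FixedOn.card_le {n m : ℕ} {U : Finset (Fin n)} {A : Finset (Fin n → Fin m → Bool)}
    (h : FixedOn U A) : A.card ≤ (2 ^ m) ^ (n - U.card) := by
  have h1 : A.card ≤ (univ : Finset ((Uᶜ : Finset (Fin n)) → Fin m → Bool)).card := by
    refine card_le_card_of_injOn (fun x i => x i) (fun _ _ => mem_coe.mpr (mem_univ _)) ?_
    intro x hx y hy hxy
    funext i
    by_cases hi : i ∈ U
    · exact h x hx y hy i hi
    · exact congrFun hxy ⟨i, mem_compl.mpr hi⟩
  refine h1.trans (le_of_eq ?_)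
  rw [card_univ, Fintype.card_fun, Fintype.card_coe, card_compl]
  simp

lemma deficiency_nonneg {n m : ℕ} {U : Finset (Fin n)} {A B : Finset (Fin n → Fin m → Bool)}
    (hA : FixedOn U A) (hB : FixedOn U B) : 0 ≤ deficiency U A B := by
  rw [deficiency, sub_nonneg]
  have hU : U.card ≤ n := by simpa using card_le_univ U
  rcases (Nat.zero_le (A.card * B.card)).eq_or_lt with h0 | h0
  · have h1 : (A.card * B.card : ℝ) = 0 := by exact_mod_cast h0.symm
    have h2 : (U.card : ℝ) ≤ n := by exact_mod_cast hU
    rw [h1, Real.logb_zero]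
    have : 0 ≤ (n : ℝ) - U.card := by linarith
    positivity
  · have h1 : A.card * B.card ≤ 2 ^ (2 * m * (n - U.card)) := by
      calc _ ≤ (2 ^ m) ^ (n - U.card) * (2 ^ m) ^ (n - U.card) := Nat.mul_le_mul hA.card_le hB.card_le
        _ = _ := by rw [← pow_mul, ← pow_add]; congr 1; ring
    have h2 : (A.card * B.card : ℝ) ≤ 2 ^ (2 * m * (n - U.card)) := by exact_mod_cast h1
    have h3 := Real.logb_le_logb_of_le (b := 2) (by norm_num) (by exact_mod_cast h0) h2
    rw [Real.logb_pow, Real.logb_self_eq_one (by norm_num), mul_one] at h3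
    push_cast [Nat.cast_sub hU] at h3
    exact h3

lemma gapMajIP_eq_some_true {n m : ℕ} {x y : Fin n → Fin m → Bool}
    (h : 2 * n ≤ 3 * weight (gadgets x y)) : gapMajIP n m x y = some true := by
  have h' : 2 * n ≤ 3 * weight fun i => innerProd (x i) (y i) := h
  rw [gapMajIP, gapMaj, if_pos h']

lemma gapMajIP_eq_some_false {n m : ℕ} (hn : 0 < n) {x y : Fin n → Fin m → Bool}
    (h : 3 * weight (gadgets x y) ≤ n) : gapMajIP n m x y = some false := by
  have h' : 3 * (weight fun i => innerProd (x i) (y i)) ≤ n := h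
  rw [gapMajIP, gapMaj, if_neg (by omega), if_pos h']

lemma isState_univ {n m k : ℕ} {Q : ℝ}
    {f : (Fin n → Fin m → Bool) → (Fin n → Fin m → Bool) → Bool} (hn : 0 < n)
    (hf : IsCompletion (gapMajIP n m) f) (hR : IsRate n m Q) (hk : 3 * k ≤ n) :
    IsState f Q k ∅ univ univ := by
  have hQ := hR.pos
  have hfix : FixedOn ∅ (univ : Finset (Fin n → Fin m → Bool)) := fun _ _ _ _ i hi => by simp at hi
  have hcard : ((univ : Finset (Fin n → Fin m → Bool)).card : ℝ) = (2 ^ m) ^ n := by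
    simp
  have hQm : Q ≤ 2 ^ m := by
    refine le_of_pow_le_pow_left₀ (n := 4) (by norm_num) (by positivity) ?_
    rw [hR.pow_four, ← pow_mul]
    exact pow_le_pow_right₀ (by norm_num) (by omega)
  have hspread : Spread Q ∅ (2 * (univ : Finset (Fin n → Fin m → Bool)).card)
      (univ : Finset (Fin n → Fin m → Bool)) := by
    intro T a _
    have h1 : FixedOn T (fiber (univ : Finset (Fin n → Fin m → Bool)) T a) :=
      fun x hx y hy i hi => by rw [(mem_fiber.mp hx).2 i hi, (mem_fiber.mp hy).2 i hi]
    have h2 : ((fiber (univ : Finset (Fin n → Fin m → Bool)) T a).card : ℝ)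
        ≤ (2 ^ m) ^ (n - T.card) := by exact_mod_cast h1.card_le
    have h3 : T.card ≤ n := by simpa using card_le_univ T
    rw [hcard]
    calc _ ≤ ((2 : ℝ) ^ m) ^ (n - T.card) * (2 ^ m) ^ T.card := by gcongr
      _ = (2 ^ m) ^ n := by rw [← pow_add, Nat.sub_add_cancel h3]
      _ ≤ _ := by
        have : (0 : ℝ) ≤ (2 ^ m) ^ n := by positivity
        linarith
  refine ⟨hfix, hfix, hspread, hspread, ?_, ?_⟩
  · have h1 := (hR.sliceCount_bounds hfix hfix hspread hspread
      (mem_univ fun _ _ => false) (mem_univ fun _ _ => false) k).1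
    have h2 : onesIn (∅ : Finset (Fin n)) (fun _ _ => false : Fin n → Fin m → Bool)
      (fun _ _ => false) = 0 := by simp [onesIn]
    rw [h2, add_zero, hcard] at h1
    refine lt_of_lt_of_le ?_ h1
    have h3 : 0 < ((∅ : Finset (Fin n))ᶜ).card.choose k := by
      refine Nat.choose_pos ?_
      simp
      omega
    positivity
  · have h1 : errorCount f k univ univ = 0 := by
      refine sum_eq_zero fun x _ => sum_eq_zero fun y _ => if_neg ?_
      rintro ⟨h1, h2⟩
      have := hf x y false (gapMajIP_eq_some_false hn (by omega))
      rw [this] at h2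
      exact Bool.false_ne_true h2
    rw [h1]
    have := sliceCount_nonneg k (univ : Finset (Fin n → Fin m → Bool)) univ
    linarith

lemma deficiency_univ {n m : ℕ} :
    deficiency (∅ : Finset (Fin n)) (univ : Finset (Fin n → Fin m → Bool)) univ = 0 := by
  have hcard : ((univ : Finset (Fin n → Fin m → Bool)).card : ℝ) = 2 ^ (m * n) := by
    simp [pow_mul]
  rw [deficiency, hcard, ← pow_add, Real.logb_pow, Real.logb_self_eq_one (by norm_num)]
  push_cast
  simp
  ring

/-- A good rectangle for a slice gives one for a higher slice, with the number of fixed coordinates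
under control. -/
lemma exists_state_succ {n m q j k : ℕ} {Q D : ℝ}
    {f : (Fin n → Fin m → Bool) → (Fin n → Fin m → Bool) → Bool} (hR : IsRate n m Q)
    (hm : 0 < m)
    {μ : RandProtocol (Fin n → Fin m → Bool) (Fin n → Fin m → Bool)}
    (hμ : μ.Computes (ofTotal f)) (hq : μ.CostLE q) (hj : 0 < j) (hjn : j * j ≤ n)
    (hn : 400 ≤ n) (hqm : 80 * (80 * q + 120) ≤ m * j) (hk : 3 * k < 2 * n)
    (hD : 40 * D ≤ (m / 2 : ℝ) * n)
    (h : ∃ U A B, IsState f Q k U A B ∧ 12 * deficiency U A B + m / 2 * U.card ≤ D) :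
    ∃ U A B, IsState f Q (k + j) U A B ∧
      12 * deficiency U A B + m / 2 * U.card ≤ D + (80 * q + 120) := by
  classical
  have hm' : (0 : ℝ) < m := by exact_mod_cast hm
  -- Start from a state within budget that has the most fixed blocks.
  obtain ⟨I, hI, hmax⟩ := (univ.filter fun U => ∃ A B, IsState f Q k U A B ∧
    12 * deficiency U A B + m / 2 * U.card ≤ D).exists_max_image Finset.card (by
      obtain ⟨U, hU⟩ := h
      exact ⟨U, mem_filter.mpr ⟨mem_univ _, hU⟩⟩)
  obtain ⟨X, Y, hst, hdef⟩ := (mem_filter.mp hI).2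
  have hd0 := deficiency_nonneg hst.fixedA hst.fixedB
  have hIc : 40 * I.card ≤ n := by
    have h1 : (m / 2 : ℝ) * (40 * I.card) ≤ m / 2 * n := by linarith
    have h2 := le_of_mul_le_mul_left h1 (by positivity)
    exact_mod_cast h2
  have hj20 : 20 * j ≤ n := by
    by_contra! hlt
    nlinarith
  obtain ⟨A, B, U, hIU, hsize, hstay, hstep⟩ := hst.advance (M := n / 6) hR hμ hq hj (by omega)
    (by omega)
  have hc := card_le_card hIU
  obtain ⟨r, hr⟩ := Nat.exists_eq_add_of_le hc
  rw [hr] at hsize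
  push_cast at hsize
  -- If many blocks get fixed, the drop in deficiency pays for the whole step, so the result is
  -- again a state at slice k within budget D with more fixed blocks, contradicting maximality.
  -- Otherwise 40 r ≤ j, hence 2 j r ≤ j² / 20 ≤ n / 20.
  by_cases hbig : 0 < r ∧ 2 * (80 * q + 120) ≤ m * r
  · exfalso
    have h1 : (2 * (80 * q + 120) : ℝ) ≤ m * r := by exact_mod_cast hbig.2
    have h2 := hmax U (mem_filter.mpr ⟨mem_univ _, A, B, hstay, by
      rw [hr]
      push_cast
      linarith⟩)
    omega
  · have hr2 : m * r ≤ 2 * (80 * q + 120) := by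
      by_cases h0 : 0 < r
      · by_contra! hlt
        exact hbig ⟨h0, hlt.le⟩
      · have : r = 0 := by omega
        subst this
        simp
    refine ⟨U, A, B, hstep ?_, ?_⟩
    · rw [hr, Nat.add_sub_cancel_left]
      have h1 : m * (40 * r) ≤ m * j := by linarith
      have h2 : 40 * r ≤ j := Nat.le_of_mul_le_mul_left h1 hm
      have h3 : 40 * (j * r) ≤ j * j := by nlinarith
      omega
    · rw [hr]
      push_cast
      have : (0 : ℝ) ≤ m * r := by positivity
      linarith

/-- Otherwise slices ⌊n/3⌋ + s j are climbed until the first one with k ≥ 2n/3. There f is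
identically 1 on a nonempty slice, yet is supposed to be 0 on half of it. -/
theorem IsCompletion.lt_cost {n m q : ℕ} {Q : ℝ}
    {f : (Fin n → Fin m → Bool) → (Fin n → Fin m → Bool) → Bool}
    (hf : IsCompletion (gapMajIP n m) f) (hR : IsRate n m Q) (hm : 0 < m) (hn : 400 ≤ n)
    {μ : RandProtocol (Fin n → Fin m → Bool) (Fin n → Fin m → Bool)}
    (hμ : μ.Computes (ofTotal f)) (hq : μ.CostLE q) :
    m * n.sqrt < 80 * (80 * q + 120) := by
  by_contra! hqm
  set j := n.sqrt with hjdef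
  have hj : 0 < j := Nat.sqrt_pos.mpr (by omega)
  have hjn : j * j ≤ n := Nat.sqrt_le n
  have hqm' : (80 * (80 * q + 120) : ℝ) ≤ m * j := by exact_mod_cast hqm
  have key : ∀ s, (∀ t < s, 3 * (n / 3 + t * j) < 2 * n) →
      ∃ U A B, IsState f Q (n / 3 + s * j) U A B ∧
        12 * deficiency U A B + m / 2 * U.card ≤ s * (80 * q + 120) := by
    intro s
    induction s with
    | zero =>
      intro _
      refine ⟨∅, univ, univ, ?_, by simp [deficiency_univ]⟩
      rw [zero_mul, add_zero]
      exact isState_univ (by omega) hf hR (by omega)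
    | succ s ih =>
      intro hs
      have h1 := hs s (by omega)
      -- The budget after s steps is s (80q + 120), at most s m j / 80 ≤ m n / 80.
      have h2 := exists_state_succ hR hm hμ hq hj hjn hn hqm h1 (D := s * (80 * q + 120)) (by
        have h3 : s * j ≤ n := by omega
        have h4 : (s * j : ℝ) ≤ n := by exact_mod_cast h3
        have h5 : (m : ℝ) * (s * j) ≤ m * n := by gcongr
        have h6 : (s : ℝ) * (80 * (80 * q + 120)) ≤ s * (m * j) := by gcongr
        linarith) (ih fun t ht => hs t (by omega))
      rw [show n / 3 + (s + 1) * j = n / 3 + s * j + j by ring]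
      push_cast
      rw [add_mul, one_mul]
      exact h2
  have hex : ∃ s, 2 * n ≤ 3 * (n / 3 + s * j) := ⟨n, by
    have := Nat.le_mul_of_pos_right n hj
    omega⟩
  obtain ⟨U, A, B, hst, -⟩ := key (Nat.find hex) fun t ht => not_le.mp (Nat.find_min hex ht)
  have hs := Nat.find_spec hex
  have herr : errorCount f (n / 3 + Nat.find hex * j) A B
      = sliceCount (n / 3 + Nat.find hex * j) A B := by
    refine sum_congr rfl fun x _ => sum_congr rfl fun y _ => if_congr ⟨fun h => h.1, fun h => ?_⟩ rfl rfl
    exact ⟨h, hf x y true (gapMajIP_eq_some_true (by omega))⟩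
  have h1 := hst.error
  have h2 := hst.pos
  rw [herr] at h1
  linarith

/-! ### Choice of parameters for logarithmic gadgets. -/

lemma le_gadgetSize (n : ℕ) : 100 * Real.logb 2 n ≤ gadgetSize n := Nat.le_ceil _

lemma one_le_logb_two {n : ℕ} (hn : 2 ≤ n) : 1 ≤ Real.logb 2 n := by
  rw [Real.le_logb_iff_rpow_le (by norm_num) (by exact_mod_cast (by omega : 0 < n)), Real.rpow_one]
  exact_mod_cast hn

lemma gadgetSize_le {n : ℕ} (hn : 2 ≤ n) : (gadgetSize n : ℝ) ≤ 101 * Real.logb 2 n := by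
  have h1 := one_le_logb_two hn
  have := Nat.ceil_lt_add_one (a := 100 * Real.logb 2 n) (by linarith)
  rw [gadgetSize]
  linarith

lemma pow_hundred_le {n : ℕ} (hn : 0 < n) : (n : ℝ) ^ 100 ≤ 2 ^ gadgetSize n := by
  have hn' : (0 : ℝ) < n := by exact_mod_cast hn
  calc (n : ℝ) ^ 100 = 2 ^ (100 * Real.logb 2 n) := by
        rw [mul_comm, Real.rpow_mul (by norm_num), Real.rpow_logb (by norm_num) (by norm_num) hn']
        norm_cast
    _ ≤ (2 : ℝ) ^ (gadgetSize n : ℝ) :=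
        Real.rpow_le_rpow_of_exponent_le (by norm_num) (le_gadgetSize n)
    _ = _ := Real.rpow_natCast _ _

/-- The rate is Q = 2^(3m/4), so Q / 2^m = 2^(-m/4). Since n^100 ≤ 2^m, this is far below 1/n; the
constants 40 and 32 are absorbed by one more factor n. -/
lemma exists_isRate {n : ℕ} (hn : 40 ≤ n) : ∃ Q, IsRate n (gadgetSize n) Q := by
  set m := gadgetSize n
  have hn' : (40 : ℝ) ≤ n := by exact_mod_cast hn
  have h1 : (n : ℝ) ^ 100 ≤ 2 ^ m := pow_hundred_le (by omega)
  have hQ4 : ((2 : ℝ) ^ (3 * m / 4 : ℝ)) ^ 4 = 2 ^ (3 * m) := by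
    rw [← Real.rpow_natCast, ← Real.rpow_mul (by norm_num), ← Real.rpow_natCast 2 (3 * m)]
    congr 1
    push_cast
    ring
  refine ⟨2 ^ (3 * m / 4 : ℝ), by positivity, hQ4, ?_, ?_⟩
  · set Q : ℝ := 2 ^ (3 * m / 4 : ℝ)
    have h2 : 40 * n * Q ≤ 2 ^ m := by
      refine le_of_pow_le_pow_left₀ (n := 4) (by norm_num) (by positivity) ?_
      rw [mul_pow, hQ4]
      calc (40 * n : ℝ) ^ 4 * 2 ^ (3 * m) ≤ ((n : ℝ) * n) ^ 4 * 2 ^ (3 * m) := by gcongr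
        _ = (n : ℝ) ^ 8 * 2 ^ (3 * m) := by ring
        _ ≤ (n : ℝ) ^ 100 * 2 ^ (3 * m) := by
            gcongr
            · linarith
            · norm_num
        _ ≤ (2 : ℝ) ^ m * 2 ^ (3 * m) := by gcongr
        _ = ((2 : ℝ) ^ m) ^ 4 := by rw [← pow_add, ← pow_mul]; congr 1; ring
    rw [← mul_div_assoc, div_le_iff₀ (by positivity)]
    linarith
  · calc (32 * n : ℝ) ^ 16 ≤ (n * n) ^ 16 := by gcongr; linarith
      _ = (n : ℝ) ^ 32 := by ring
      _ ≤ n ^ 100 := by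
          gcongr
          · linarith
          · norm_num
      _ ≤ _ := h1

/-- Every protocol for a completion of `GapMaj ∘ IP` is expensive. -/
theorem IsCompletion.sqrt_mul_logb_le {n q : ℕ} (hn : 4096 ≤ n)
    {f : (Fin n → Fin (gadgetSize n) → Bool) → (Fin n → Fin (gadgetSize n) → Bool) → Bool}
    (hf : IsCompletion (gapMajIP n (gadgetSize n)) f)
    {μ : RandProtocol (Fin n → Fin (gadgetSize n) → Bool) (Fin n → Fin (gadgetSize n) → Bool)}
    (hμ : μ.Computes (ofTotal f)) (hq : μ.CostLE q) :
    1 / 256 * (Real.sqrt n * Real.logb 2 n) ≤ q := by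
  have hn' : (4096 : ℝ) ≤ n := by exact_mod_cast hn
  have hlog : 12 ≤ Real.logb 2 n := by
    rw [Real.le_logb_iff_rpow_le (by norm_num) (by linarith)]
    norm_num
    exact hn
  have hsqrt : 64 ≤ Real.sqrt n := by
    rw [show (64 : ℝ) = Real.sqrt 4096 by
      rw [show (4096 : ℝ) = 64 ^ 2 by norm_num, Real.sqrt_sq (by norm_num)]]
    exact Real.sqrt_le_sqrt hn'
  have hm := le_gadgetSize n
  obtain ⟨Q, hQ⟩ := exists_isRate (n := n) (by omega)
  have h1 := hf.lt_cost hQ (by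
    have : (0 : ℝ) < gadgetSize n := by linarith
    exact_mod_cast this) (by omega) hμ hq
  have h2 : (gadgetSize n * n.sqrt : ℝ) < 80 * (80 * q + 120) := by exact_mod_cast h1
  have h3 : Real.sqrt n / 2 ≤ n.sqrt := by
    have := Real.real_sqrt_lt_nat_sqrt_succ (a := n)
    linarith
  have h4 : 100 * Real.logb 2 n * (Real.sqrt n / 2) ≤ gadgetSize n * n.sqrt := by
    gcongr
  nlinarith

/-! ### The upper bound -/

/-- Alice sends her m bits one by one; Bob, knowing them, announces the value. -/
lemma exists_protocol_send {X Y : Type} {m : ℕ} (h : X → Fin m → Bool)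
    (g : (Fin m → Bool) → Y → Bool) :
    ∃ π : Protocol X Y, π.cost ≤ m + 1 ∧ ∀ x y, π.eval x y = g (h x) y := by
  induction m with
  | zero =>
    refine ⟨.bob (g Fin.elim0) (.output false) (.output true), by simp [Protocol.cost], ?_⟩
    intro x y
    rw [Subsingleton.elim (h x) Fin.elim0]
    cases hg : g Fin.elim0 y <;> simp [Protocol.eval, hg]
  | succ m ih =>
    obtain ⟨π₀, hc₀, h₀⟩ := ih (fun x => Fin.tail (h x)) fun a => g (Fin.cons false a)
    obtain ⟨π₁, hc₁, h₁⟩ := ih (fun x => Fin.tail (h x)) fun a => g (Fin.cons true a)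
    refine ⟨.alice (fun x => h x 0) π₀ π₁, by simp [Protocol.cost, hc₀, hc₁], ?_⟩
    intro x y
    have hx := Fin.cons_self_tail (h x)
    cases hx0 : h x 0
    · rw [hx0] at hx
      simp [Protocol.eval, hx0, h₀, hx]
    · rw [hx0] at hx
      simp [Protocol.eval, hx0, h₁, hx]

/-- Evaluating the gadget in a random block solves `GapMaj ∘ IP`. -/
lemma randCC_gapMajIP_comp_le {X Y : Type} {n m : ℕ} (hn : 0 < n) (u : X → Fin n → Fin m → Bool)
    (v : Y → Fin n → Fin m → Bool) : randCC (fun x y => gapMajIP n m (u x) (v y)) ≤ m + 1 := by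
  have : Nonempty (Fin n) := ⟨⟨0, hn⟩⟩
  choose π hcost heval using fun i : Fin n =>
    exists_protocol_send (fun x : X => u x i) fun a (y : Y) => innerProd a (v y i)
  refine Nat.sInf_le ⟨(PMF.uniformOfFintype (Fin n)).map π, ?_, ?_⟩
  · intro p hp
    obtain ⟨i, -, rfl⟩ := (PMF.mem_support_map_iff _ _ _).mp hp
    exact hcost i
  · intro x y b hb
    have h1 : RandProtocol.prob ((PMF.uniformOfFintype (Fin n)).map π) x y b
        = ((PMF.uniformOfFintype (Fin n)).map (gadgets (u x) (v y))) b := by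
      rw [RandProtocol.prob, PMF.map_comp]
      congr 2
      funext i
      exact heval i x y
    have hn' : (0 : ℝ) < n := by exact_mod_cast hn
    have h2 : (((PMF.uniformOfFintype (Fin n)).map (gadgets (u x) (v y))) b).toReal
        = (univ.filter fun i => gadgets (u x) (v y) i = b).card / n := by
      rw [PMF.map_apply_toReal]
      simp only [PMF.uniformOfFintype_apply, Fintype.card_fin, ENNReal.toReal_inv,
        ENNReal.toReal_natCast, ← mul_sum, sum_boole]
      field_simp
    have h3 : 2 * n ≤ 3 * (univ.filter fun i => gadgets (u x) (v y) i = b).card := by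
      have hb' : gapMaj (gadgets (u x) (v y)) = some b := hb
      rw [gapMaj] at hb'
      have hsplit := card_filter_add_card_filter_not (s := (univ : Finset (Fin n)))
        (fun i => gadgets (u x) (v y) i = true)
      simp only [Bool.not_eq_true, card_univ, Fintype.card_fin] at hsplit
      rw [weight] at hb'
      split_ifs at hb' with h4 h5
      · cases hb'
        exact h4
      · cases hb'
        omega
    have h4 : (2 * n : ℝ) ≤ 3 * (univ.filter fun i => gadgets (u x) (v y) i = b).card := by
      exact_mod_cast h3
    rw [h1, show (2 / 3 : ℝ≥0∞) = ENNReal.ofReal (2 / 3) by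
      rw [ENNReal.ofReal_div_of_pos (by norm_num)]; simp,
      ENNReal.ofReal_le_iff_le_toReal (PMF.apply_ne_top _ _), h2, le_div_iff₀ hn']
    linarith

/-! ### Padding -/

/-- Run a protocol on inputs that are first transformed locally. -/
def Protocol.comap {X Y X' Y' : Type} (u : X' → X) (v : Y' → Y) : Protocol X Y → Protocol X' Y'
  | .output b => .output b
  | .alice msg l r => .alice (fun x => msg (u x)) (l.comap u v) (r.comap u v)
  | .bob msg l r => .bob (fun y => msg (v y)) (l.comap u v) (r.comap u v)

lemma Protocol.eval_comap {X Y X' Y' : Type} (u : X' → X) (v : Y' → Y) (π : Protocol X Y) (x : X')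
    (y : Y') : (π.comap u v).eval x y = π.eval (u x) (v y) := by
  induction π with
  | output b => rfl
  | alice msg l r ihl ihr => simp [Protocol.comap, Protocol.eval, ihl, ihr]
  | bob msg l r ihl ihr => simp [Protocol.comap, Protocol.eval, ihl, ihr]

lemma Protocol.cost_comap {X Y X' Y' : Type} (u : X' → X) (v : Y' → Y) (π : Protocol X Y) :
    (π.comap u v).cost = π.cost := by
  induction π with
  | output b => rfl
  | alice msg l r ihl ihr => simp [Protocol.comap, Protocol.cost, ihl, ihr]
  | bob msg l r ihl ihr => simp [Protocol.comap, Protocol.cost, ihl, ihr]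

lemma RandProtocol.Computes.comap {X Y X' Y' : Type} {μ : RandProtocol X Y} {f : X → Y → Bool}
    (h : μ.Computes (ofTotal f)) (u : X' → X) (v : Y' → Y) :
    RandProtocol.Computes (PMF.map (Protocol.comap u v) μ) (ofTotal fun x y => f (u x) (v y)) := by
  intro x y b hb
  have h1 := h (u x) (v y) b hb
  rw [RandProtocol.prob, PMF.map_comp]
  have h2 : (fun π : Protocol X' Y' => π.eval x y) ∘ Protocol.comap u v
      = fun π : Protocol X Y => π.eval (u x) (v y) :=
    funext fun π => π.eval_comap u v x y
  rw [h2]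
  exact h1

lemma RandProtocol.CostLE.comap {X Y X' Y' : Type} {μ : RandProtocol X Y} {q : ℕ}
    (h : μ.CostLE q) (u : X' → X) (v : Y' → Y) :
    RandProtocol.CostLE (PMF.map (Protocol.comap u v) μ) q := by
  intro p hp
  obtain ⟨π, hπ, rfl⟩ := (PMF.mem_support_map_iff _ _ _).mp hp
  rw [Protocol.cost_comap]
  exact h π hπ

lemma exists_blocks_eq {N : ℕ} (x : Fin (blockCount N) → Fin (gadgetSize (blockCount N)) → Bool) :
    ∃ x' : Fin N → Bool, blocks x' = x := by
  have hinj : Function.Injective fun p : Fin (blockCount N) × Fin (gadgetSize (blockCount N)) =>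
      Fin.castLE (blockCount_mul_le N) (finProdFinEquiv p) := fun p p' h =>
    finProdFinEquiv.injective (Fin.castLE_injective _ h)
  refine ⟨Function.extend (fun p : Fin (blockCount N) × Fin (gadgetSize (blockCount N)) =>
    Fin.castLE (blockCount_mul_le N) (finProdFinEquiv p)) (fun p => x p.1 p.2) fun _ => false, ?_⟩
  funext i j
  exact hinj.extend_apply (fun p => x p.1 p.2) _ (i, j)

lemma blockCount_le (N : ℕ) : blockCount N ≤ N := Nat.findGreatest_le N

lemma tendsto_blockCount : Tendsto blockCount atTop atTop := by
  refine tendsto_atTop.mpr fun K => ?_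
  filter_upwards [eventually_ge_atTop (max K (K * gadgetSize K))] with N hN
  exact Nat.le_findGreatest ((le_max_left _ _).trans hN) ((le_max_right _ _).trans hN)

/-- By maximality n + 1 blocks do not fit, so N = O(n log n); hence √N is at most a multiple of √n
log n. -/
lemma sqrt_le_mul_logb_blockCount {N : ℕ} (hN : 2 ≤ blockCount N) :
    Real.sqrt N ≤ 21 * (Real.sqrt (blockCount N) * Real.logb 2 (blockCount N)) := by
  set n := blockCount N with hn
  have hn' : (2 : ℝ) ≤ n := by exact_mod_cast hN
  have hlog := one_le_logb_two hN
  have h1 : Real.logb 2 (n + 1 : ℕ) ≤ 2 * Real.logb 2 n := by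
    have h2 : (2 : ℝ) * Real.logb 2 n = Real.logb 2 ((n : ℝ) ^ 2) := by
      rw [Real.logb_pow]; norm_num
    rw [h2]
    refine Real.logb_le_logb_of_le (by norm_num) (by positivity) ?_
    push_cast
    nlinarith
  have hg := gadgetSize_le (n := n + 1) (by omega)
  have h3 : (N : ℝ) ≤ (n + 1) * (202 * Real.logb 2 n) := by
    rcases le_or_gt (n + 1) N with h | h
    · have h4 := Nat.findGreatest_is_greatest (P := fun n => n * gadgetSize n ≤ N) (k := n + 1)
        (Nat.lt_succ_self n) h
      have h5 : (N : ℝ) < (n + 1) * gadgetSize (n + 1) := by exact_mod_cast not_le.mp h4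
      refine h5.le.trans ?_
      gcongr
      linarith
    · have h4 : (N : ℝ) ≤ n + 1 := by exact_mod_cast h.le
      nlinarith
  rw [Real.sqrt_le_left (by positivity), mul_pow, mul_pow, Real.sq_sqrt (by linarith)]
  nlinarith [mul_nonneg (by linarith : (0 : ℝ) ≤ n) (by linarith : (0 : ℝ) ≤ Real.logb 2 n)]

end GapMajSep

theorem mainTheorem1 :
    (∃ c : ℝ, 0 < c ∧ ∀ᶠ n : ℕ in atTop,
      ∀ f : (Fin n → Fin (GapMajSep.gadgetSize n) → Bool) →
          (Fin n → Fin (GapMajSep.gadgetSize n) → Bool) → Bool,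
        GapMajSep.IsCompletion (GapMajSep.gapMajIP n (GapMajSep.gadgetSize n)) f →
          c * (Real.sqrt n * Real.logb 2 n) ≤ (GapMajSep.randCC (GapMajSep.ofTotal f) : ℝ)) ∧
    (∃ C : ℝ, ∀ᶠ n : ℕ in atTop,
      (GapMajSep.randCC (GapMajSep.gapMajIP n (GapMajSep.gadgetSize n)) : ℝ) ≤
        C * Real.logb 2 n) ∧
    (∃ c C : ℝ, 0 < c ∧ ∀ᶠ N : ℕ in atTop,
      (GapMajSep.randCC (GapMajSep.paddedGapMajIP N) : ℝ) ≤ C * Real.logb 2 N ∧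
      c * Real.sqrt N ≤ (GapMajSep.pseudodetCC (GapMajSep.paddedGapMajIP N) : ℝ)) := by
  open GapMajSep in
  refine ⟨⟨1 / 256, by norm_num, ?_⟩, ⟨102, ?_⟩, ⟨1 / 5376, 102, by norm_num, ?_⟩⟩
  · filter_upwards [eventually_ge_atTop 4096] with n hn f hf
    obtain ⟨μ, hcost, hμ⟩ := exists_randCC (ofTotal f)
    exact hf.sqrt_mul_logb_le hn hμ hcost
  · filter_upwards [eventually_ge_atTop 2] with n hn
    have h1 := randCC_gapMajIP_comp_le (m := gadgetSize n) (by omega : 0 < n) id id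
    have h2 : (randCC (gapMajIP n (gadgetSize n)) : ℝ) ≤ gadgetSize n + 1 := by exact_mod_cast h1
    have h3 := gadgetSize_le hn
    have h4 := one_le_logb_two hn
    linarith
  · filter_upwards [tendsto_blockCount.eventually_ge_atTop 4096] with N hN
    constructor
    · have h1 := randCC_gapMajIP_comp_le (by omega : 0 < blockCount N) (blocks (N := N))
        (blocks (N := N))
      have h2 : (randCC (paddedGapMajIP N) : ℝ) ≤ gadgetSize (blockCount N) + 1 := by
        exact_mod_cast h1
      have h3 := gadgetSize_le (n := blockCount N) (by omega)
      have h4 := one_le_logb_two (n := blockCount N) (by omega)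
      have h5 : Real.logb 2 (blockCount N) ≤ Real.logb 2 N :=
        Real.logb_le_logb_of_le (by norm_num) (by exact_mod_cast (by omega : 0 < blockCount N))
          (by exact_mod_cast blockCount_le N)
      linarith
    · obtain ⟨μ, hcost, f, hf, hμ⟩ := exists_pseudodetCC (paddedGapMajIP N)
      -- A right inverse of `blocks` embeds the unpadded problem, so a protocol for the padded one
      -- yields a completion of `gapMajIP` at the same cost.
      choose u hu using exists_blocks_eq (N := N)
      have hf' : IsCompletion (gapMajIP (blockCount N) (gadgetSize (blockCount N)))
          fun x y => f (u x) (u y) := by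
        intro x y b hb
        refine hf (u x) (u y) b ?_
        rw [paddedGapMajIP, hu, hu]
        exact hb
      have h1 := hf'.sqrt_mul_logb_le hN (hμ.comap u u) (hcost.comap u u)
      have h2 := sqrt_le_mul_logb_blockCount (N := N) (by omega)
      linarith
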